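/- Let $M\subset\mathbb R^d$ be finite. For $u\in M$ let $\mathrm{Vor}(u)=\{x:\|x-u\|\le\|x-q\|\ \forall q\in M\}$; let $r(u)$ be half the distance from $u$ to the nearest other point of $M$, and let $R(u)$ be the radius of the smallest ball centered at $u$ that contains all corners (vertices) of $\mathrm{Vor}(u)$. $M$ is $\tau''$-well-spaced if $R(u)/r(u)\le\tau''$ for all $u\in M$. Two points of $M$ form a Delaunay edge if their Voronoi cells share a $(d-1)$-dimensional face. An approximate Delaunay graph of $M$ is a graph on $M$ that contains all Delaunay edges and all of whose edges $uv$ satisfy $\|u-v\|\le 2\tau''\min\{r(u),r(v)\}$. Theorem. There is one real-RAM algorithm (exact real numbers; the operations $+,-,\times,/,\sqrt{\cdot}$, comparisons, indirect addressing with index arithmetic, each at unit cost) such that for every constant $\tau''>1$ the following holds, where the constants hidden in $O(\cdot)$ depend only on $\tau''$. Let $M\subset\mathbb R^d$ be a finite $\tau''$-well-spaced set with an approximate Delaunay graph $G$, let $p\in M$, let $c\in\mathbb R^d$ with $\|c\|=1$, and let $0<\varepsilon<1$. Suppose that $w$ is a farthest corner of $\mathrm{Vor}(p)$ in the direction of $c$,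 i.e. a corner of $\mathrm{Vor}(p)$ with $w^Tc=\max_{x\in\mathrm{Vor}(p)}x^Tc$ (it exists for every $c$ if $\mathrm{Vor}(p)$ is bounded). Given $d$, $\tau''$, $\varepsilon$, $c$, the point $p$ and the list of the neighbors of $p$ in $G$ (in any order), the algorithm computes, in time $$2^{O(d)}\cdot O\!\left(\log^2(\tau''/\varepsilon)\right),$$ a point $z\in\mathrm{Vor}(p)$ with $(z-p)^Tc\ \ge\ (1-\varepsilon)\,(w-p)^Tc$. -/

import Mathlib

/-!  ## A real random access machine

Programs are structured (while-)programs over a memory that consists of index registers holding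
natural numbers and of two-dimensional arrays holding exact real numbers.  Array entries are
addressed indirectly, through the values of index registers.  Registers and arrays are named by
natural numbers; a program mentions only finitely many of them.  Every operation costs one unit. -/

namespace RealRAM

/-- Memory contents: `idx x` is the value of index register `x`, and `arr a i j` is the real number
in row `i` and column `j` of array `a`. -/
structure State where
  idx : ℕ → ℕ
  arr : ℕ → ℕ → ℕ → ℝ

/-- Index expressions: literals, registers, addition and truncated subtraction (there is no
multiplication of indices). -/
inductive IExp where
  | lit (n : ℕ)
  | reg (x : ℕ)
  | add (e f : IExp)
  | sub (e f : IExp)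

namespace IExp

def eval (s : State) : IExp → ℕ
  | lit n => n
  | reg x => s.idx x
  | add e f => e.eval s + f.eval s
  | sub e f => e.eval s - f.eval s

/-- The number of operations performed when the expression is evaluated. -/
def cost : IExp → ℕ
  | lit _ => 1
  | reg _ => 1
  | add e f => e.cost + f.cost + 1
  | sub e f => e.cost + f.cost + 1

end IExp

/-- Real expressions: conversion of an index into a real number, array access, the four arithmetic
operations and the square root.  There are no real constants other than natural numbers, and there
is no rounding and no conversion from reals to indices. -/
inductive RExp where
  | ofIdx (e : IExp)
  | get (a : ℕ) (i j : IExp)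
  | add (e f : RExp)
  | sub (e f : RExp)
  | mul (e f : RExp)
  | div (e f : RExp)
  | sqrt (e : RExp)

namespace RExp

noncomputable def eval (s : State) : RExp → ℝ
  | ofIdx e => (e.eval s : ℝ)
  | get a i j => s.arr a (i.eval s) (j.eval s)
  | add e f => e.eval s + f.eval s
  | sub e f => e.eval s - f.eval s
  | mul e f => e.eval s * f.eval s
  | div e f => e.eval s / f.eval s
  | sqrt e => Real.sqrt (e.eval s)

/-- The number of operations performed when the expression is evaluated. -/
def cost : RExp → ℕ
  | ofIdx e => e.cost + 1
  | get _ i j => i.cost + j.cost + 1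
  | add e f => e.cost + f.cost + 1
  | sub e f => e.cost + f.cost + 1
  | mul e f => e.cost + f.cost + 1
  | div e f => e.cost + f.cost + 1
  | sqrt e => e.cost + 1

end RExp

/-- Tests: exact comparisons of indices and of reals, and their Boolean combinations. -/
inductive Test where
  | idxLE (e f : IExp)
  | realLE (e f : RExp)
  | not (b : Test)
  | and (b b' : Test)

namespace Test

def Holds (s : State) : Test → Prop
  | idxLE e f => e.eval s ≤ f.eval s
  | realLE e f => e.eval s ≤ f.eval s
  | not b => ¬ b.Holds s
  | and b b' => b.Holds s ∧ b'.Holds s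

/-- The number of operations performed when the test is evaluated. -/
def cost : Test → ℕ
  | idxLE e f => e.cost + f.cost + 1
  | realLE e f => e.cost + f.cost + 1
  | not b => b.cost + 1
  | and b b' => b.cost + b'.cost + 1

end Test

/-- Programs. -/
inductive Prog where
  | skip
  | setIdx (x : ℕ) (e : IExp)
  | setReal (a : ℕ) (i j : IExp) (e : RExp)
  | seq (P Q : Prog)
  | branch (b : Test) (P Q : Prog)
  | loop (b : Test) (P : Prog)

/-- The memory after the assignment of `n` to index register `x`. -/
def State.writeIdx (s : State) (x n : ℕ) : State :=
  { s with idx := fun x' => if x' = x then n else s.idx x' }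

/-- The memory after the assignment of `v` to entry `(i, j)` of array `a`. -/
def State.writeReal (s : State) (a i j : ℕ) (v : ℝ) : State :=
  { s with arr := fun a' i' j' => if a' = a ∧ i' = i ∧ j' = j then v else s.arr a' i' j' }

/-- `Exec P s s' n`: started with memory `s`, the program `P` halts with memory `s'` after exactly
`n` steps.  (`loop b P` is `while b do P`.) -/
inductive Exec : Prog → State → State → ℕ → Prop where
  | skip (s : State) : Exec .skip s s 1
  | setIdx (s : State) (x : ℕ) (e : IExp) :
      Exec (.setIdx x e) s (s.writeIdx x (e.eval s)) (e.cost + 1)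
  | setReal (s : State) (a : ℕ) (i j : IExp) (e : RExp) :
      Exec (.setReal a i j e) s (s.writeReal a (i.eval s) (j.eval s) (e.eval s))
        (i.cost + j.cost + e.cost + 1)
  | seq {P Q : Prog} {s s' s'' : State} {n n' : ℕ} :
      Exec P s s' n → Exec Q s' s'' n' → Exec (.seq P Q) s s'' (n + n')
  | branchTrue {b : Test} {P Q : Prog} {s s' : State} {n : ℕ} :
      b.Holds s → Exec P s s' n → Exec (.branch b P Q) s s' (b.cost + n)
  | branchFalse {b : Test} {P Q : Prog} {s s' : State} {n : ℕ} :
      ¬ b.Holds s → Exec Q s s' n → Exec (.branch b P Q) s s' (b.cost + n)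
  | loopTrue {b : Test} {P : Prog} {s s' s'' : State} {n n' : ℕ} :
      b.Holds s → Exec P s s' n → Exec (.loop b P) s' s'' n' →
        Exec (.loop b P) s s'' (b.cost + n + n')
  | loopFalse {b : Test} {P : Prog} {s : State} :
      ¬ b.Holds s → Exec (.loop b P) s s b.cost

end RealRAM

/-!  ## Voronoi cells, well-spaced points, approximate Delaunay graphs -/

namespace VoronoiMesh

/-- `d`-dimensional Euclidean space. -/
abbrev Pt (d : ℕ) : Type := EuclideanSpace ℝ (Fin d)

variable {d : ℕ}

/-- The Voronoi cell of `p` in the diagram of `M`: the points with no point of `M` nearer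
than `p`. -/
def voronoiCell (M : Finset (Pt d)) (p : Pt d) : Set (Pt d) :=
  {x | ∀ q ∈ M, dist x p ≤ dist x q}

/-- The inradius of the Voronoi cell of `u`: half the distance from `u` to its nearest neighbor. -/
noncomputable def inradius (M : Finset (Pt d)) (u : Pt d) : ℝ :=
  Metric.infDist u ((M : Set (Pt d)) \ {u}) / 2

/-- The corners (vertices) of the Voronoi cell of `u`. -/
def corners (M : Finset (Pt d)) (u : Pt d) : Set (Pt d) :=
  (voronoiCell M u).extremePoints ℝ

/-- The outradius of the Voronoi cell of `u`: the radius of the smallest ball centered at `u` that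
contains all corners of the cell. -/
noncomputable def outradius (M : Finset (Pt d)) (u : Pt d) : ENNReal :=
  ⨆ v ∈ corners M u, edist u v

noncomputable def aspectRatio (M : Finset (Pt d)) (u : Pt d) : ENNReal :=
  outradius M u / ENNReal.ofReal (inradius M u)

/-- `M` is `τ`-well-spaced. -/
def IsWellSpaced (M : Finset (Pt d)) (τ : ℝ) : Prop :=
  ∀ u ∈ M, aspectRatio M u ≤ ENNReal.ofReal τ

/-- `u` and `v` are joined by an edge of the Delaunay triangulation, the dual of the Voronoi
diagram: their Voronoi cells share a face of dimension `d - 1`. -/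
def DelaunayEdge (M : Finset (Pt d)) (u v : Pt d) : Prop :=
  u ∈ M ∧ v ∈ M ∧ u ≠ v ∧ (voronoiCell M u ∩ voronoiCell M v).Nonempty ∧
    Module.finrank ℝ (vectorSpan ℝ (voronoiCell M u ∩ voronoiCell M v)) + 1 = d

/-- `G` is an approximate Delaunay graph of a mesh `M` of quality `τ`: a graph on the points of `M`
that contains all Delaunay edges and has no edge that is too long, compared to the inradii at its
endpoints, for the Delaunay graph of a `τ`-well-spaced set. -/
structure IsApproxDelaunayGraph (M : Finset (Pt d)) (τ : ℝ) (G : SimpleGraph (Pt d)) : Prop where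
  mem : ∀ u v, G.Adj u v → u ∈ M ∧ v ∈ M
  delaunay : ∀ u v, DelaunayEdge M u v → G.Adj u v
  pruned : ∀ u v, G.Adj u v → dist u v ≤ 2 * τ * min (inradius M u) (inradius M v)

/-- `w` is a farthest corner of the Voronoi cell of `p` in the direction `c`: a corner at which the
inner product with `c` is maximal over the whole cell. -/
def IsFarthestCorner (M : Finset (Pt d)) (p c w : Pt d) : Prop :=
  w ∈ corners M p ∧ ∀ x ∈ voronoiCell M p, inner ℝ x c ≤ inner ℝ w c

/-- The initial memory.  Index registers `0` and `1` hold the dimension `d` and the number `m` of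
neighbors; array `0` holds `τ` and `ε` in its first two entries; the first rows of arrays `1` and
`2` hold the coordinates of `p` and of `c`; row `k < m` of array `3` holds the coordinates of the
neighbor `q k`.  Everything else is `0`. -/
noncomputable def input (τ ε : ℝ) (p c : Pt d) {m : ℕ} (q : Fin m → Pt d) : RealRAM.State where
  idx x := if x = 0 then d else if x = 1 then m else 0
  arr a i j :=
    if a = 0 then (if i = 0 ∧ j = 0 then τ else if i = 0 ∧ j = 1 then ε else 0)
    else if a = 1 then (if h : j < d then (if i = 0 then p ⟨j, h⟩ else 0) else 0)
    else if a = 2 then (if h : j < d then (if i = 0 then c ⟨j, h⟩ else 0) else 0)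
    else if a = 3 then
      (if hi : i < m then (if hj : j < d then q ⟨i, hi⟩ ⟨j, hj⟩ else 0) else 0)
    else 0

/-- The output: the point whose coordinates are in the first row of array `4`. -/
noncomputable def output (d : ℕ) (s : RealRAM.State) : Pt d :=
  WithLp.toLp 2 fun j => s.arr 4 0 j

end VoronoiMesh

/-! The algorithm is the ellipsoid method with central cuts, applied to `Vor(p)`. Two geometric
facts make it applicable.

First, `Vor(p)` is the intersection of the half-spaces on the side of `p` of the bisectors with the
neighbors of `p` in `G`. A minimal family of bisectors that cuts out the cell consists of Delaunay
neighbors (`mem_voronoiCell_of_forall_delaunayEdge`), and `G` contains all Delaunay edges. Packing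
bounds the number of neighbors by `(2τ²+1)^d` (`card_neighbors_le`), so testing membership, or
finding a violated half-space, takes `2^O(d)` steps.

Second, the inradius `r` of the cell at `p` is unknown, but the distance `D` from `p` to any one
neighbor satisfies `2r ≤ D ≤ 2τr`. Hence the ball of radius `R = τD/2` around `p` contains the
farthest corner `w`. Shrinking the inscribed ball `B(p, r)` towards `w` by the factor `ε/2` gives a
ball of `(1-ε)`-optimal points inside the cell and inside `B(p, R)`. It contains a ball `T` of
radius `(ε/(2τ²))·R` (`exists_closedBall_nearly_optimal`).

The method starts with `B(p, R)` and keeps an ellipsoid that contains `T` as long as the best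
recorded point is not good enough. If the center violates a bisector, that direction is cut;
otherwise the center is recorded if it is not worse, and the points with smaller objective value
than the center are cut off. A cut multiplies the volume by at most `(1-1/(8d²))^d`
(`subset_ellipsoid_cutMap`, `det_cutMap`, `cut_factor_le`). After about `8d²·log(2τ²/ε)` rounds the
ellipsoid is too small to contain `T`, so the recorded point is good. The ellipsoid is stored
through a linear map `A` whose image of the unit ball it is, so a cut is a rank-one update of `A`
and the volume is `det A` up to a constant.

The number of rounds is only linear in the logarithm; the squared logarithm of the claim dominates
it because `log(τ/ε) ≥ log τ > 0`. -/

namespace RealRAM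

/-! ### A calculus of total correctness with step counts -/

@[simp] theorem State.writeIdx_idx (s : State) (x n y : ℕ) :
    (s.writeIdx x n).idx y = if y = x then n else s.idx y := rfl

@[simp] theorem State.writeIdx_arr (s : State) (x n : ℕ) : (s.writeIdx x n).arr = s.arr := rfl

@[simp] theorem State.writeReal_idx (s : State) (a i j : ℕ) (v : ℝ) :
    (s.writeReal a i j v).idx = s.idx := rfl

@[simp] theorem State.writeReal_arr (s : State) (a i j : ℕ) (v : ℝ) (a' i' j' : ℕ) :
    (s.writeReal a i j v).arr a' i' j' =
      if a' = a ∧ i' = i ∧ j' = j then v else s.arr a' i' j' := rfl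

theorem State.writeReal_arr_of_ne (s : State) {a a' : ℕ} (h : a' ≠ a) (i j : ℕ) (v : ℝ) :
    (s.writeReal a i j v).arr a' = s.arr a' := by
  funext i' j'; simp [h]

/-- Total correctness within `B` steps: started in `s`, the program `P` halts after at most `B`
steps in a state that satisfies `Q`. -/
def Achieves (P : Prog) (s : State) (B : ℕ) (Q : State → Prop) : Prop :=
  ∃ s' n, Exec P s s' n ∧ n ≤ B ∧ Q s'

namespace Achieves

theorem mono {P : Prog} {s : State} {B B' : ℕ} {Q Q' : State → Prop} (h : Achieves P s B Q)
    (hB : B ≤ B') (hQ : ∀ t, Q t → Q' t) : Achieves P s B' Q' := by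
  obtain ⟨t, n, he, hn, hq⟩ := h
  exact ⟨t, n, he, hn.trans hB, hQ t hq⟩

theorem skip {s : State} {B : ℕ} {Q : State → Prop} (hB : 1 ≤ B) (hQ : Q s) :
    Achieves .skip s B Q :=
  ⟨s, 1, .skip s, hB, hQ⟩

theorem setIdx {s : State} {x : ℕ} {e : IExp} {B : ℕ} {Q : State → Prop} (hB : e.cost + 1 ≤ B)
    (hQ : Q (s.writeIdx x (e.eval s))) : Achieves (.setIdx x e) s B Q :=
  ⟨_, _, .setIdx s x e, hB, hQ⟩

theorem setReal {s : State} {a : ℕ} {i j : IExp} {e : RExp} {B : ℕ} {Q : State → Prop}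
    (hB : i.cost + j.cost + e.cost + 1 ≤ B)
    (hQ : Q (s.writeReal a (i.eval s) (j.eval s) (e.eval s))) :
    Achieves (.setReal a i j e) s B Q :=
  ⟨_, _, .setReal s a i j e, hB, hQ⟩

theorem seq {P P' : Prog} {s : State} {B B' : ℕ} {Q Q' : State → Prop} (h : Achieves P s B Q)
    (h' : ∀ t, Q t → Achieves P' t B' Q') : Achieves (.seq P P') s (B + B') Q' := by
  obtain ⟨t, n, he, hn, hq⟩ := h
  obtain ⟨u, n', he', hn', hq'⟩ := h' t hq
  exact ⟨u, _, .seq he he', add_le_add hn hn', hq'⟩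

/-- `seq` for a given budget `B`. -/
theorem seqOf {P P' : Prog} {s : State} {B B₁ : ℕ} {Q Q' : State → Prop} (h : Achieves P s B₁ Q)
    (hB : B₁ ≤ B) (h' : ∀ t, Q t → Achieves P' t (B - B₁) Q') : Achieves (.seq P P') s B Q' :=
  (h.seq h').mono (by omega) fun _ ht => ht

theorem branch {b : Test} {P P' : Prog} {s : State} {B : ℕ} {Q : State → Prop}
    (h : b.Holds s → Achieves P s B Q) (h' : ¬ b.Holds s → Achieves P' s B Q) :
    Achieves (.branch b P P') s (b.cost + B) Q := by
  by_cases hb : b.Holds s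
  · obtain ⟨t, n, he, hn, hq⟩ := h hb
    exact ⟨t, _, .branchTrue hb he, by omega, hq⟩
  · obtain ⟨t, n, he, hn, hq⟩ := h' hb
    exact ⟨t, _, .branchFalse hb he, by omega, hq⟩

/-- A loop with a numbered invariant whose guard fails once the number reaches `N`. -/
theorem loop {b : Test} {P : Prog} {I : ℕ → State → Prop} {N B : ℕ}
    (hstep : ∀ k t, I k t → b.Holds t → k < N ∧ Achieves P t B (I (k + 1)))
    {s : State} (h0 : I 0 s) :
    Achieves (.loop b P) s (N * (B + b.cost) + b.cost)
      (fun t => ¬ b.Holds t ∧ ∃ k ≤ N, I k t) := by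
  -- Induction on the number `r = N - k` of rounds that may still follow.
  have key : ∀ r k s, k ≤ N → N - k = r → I k s →
      Achieves (.loop b P) s (r * (B + b.cost) + b.cost)
        (fun t => ¬ b.Holds t ∧ ∃ k ≤ N, I k t) := by
    intro r
    induction r with
    | zero =>
      intro k s hk hr hI
      have hb : ¬ b.Holds s := fun hb => by have := (hstep k s hI hb).1; omega
      exact ⟨s, _, .loopFalse hb, by simp, hb, k, hk, hI⟩
    | succ r ih =>
      intro k s hk hr hI
      by_cases hb : b.Holds s
      · obtain ⟨hlt, t, n, he, hn, hq⟩ := hstep k s hI hb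
        obtain ⟨u, n', he', hn', hq'⟩ := ih (k + 1) t hlt (by omega) hq
        refine ⟨u, _, .loopTrue hb he he', ?_, hq'⟩
        rw [Nat.succ_mul]; omega
      · exact ⟨s, _, .loopFalse hb, by simp, hb, k, hk, hI⟩
  simpa using key N 0 s (Nat.zero_le _) (by simp) h0

end Achieves

/-- `t` agrees with `s` outside of the index registers in `X` and the arrays in `A`. -/
structure Frame (X A : List ℕ) (s t : State) : Prop where
  idx : ∀ y, y ∉ X → t.idx y = s.idx y
  arr : ∀ a, a ∉ A → t.arr a = s.arr a

namespace Frame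

theorem refl (X A : List ℕ) (s : State) : Frame X A s s := ⟨fun _ _ => rfl, fun _ _ => rfl⟩

theorem trans {X A : List ℕ} {s t u : State} (h : Frame X A s t) (h' : Frame X A t u) :
    Frame X A s u :=
  ⟨fun y hy => (h'.idx y hy).trans (h.idx y hy), fun a ha => (h'.arr a ha).trans (h.arr a ha)⟩

theorem mono {X A X' A' : List ℕ} {s t : State} (h : Frame X A s t) (hX : X ⊆ X') (hA : A ⊆ A') :
    Frame X' A' s t :=
  ⟨fun y hy => h.idx y fun hy' => hy (hX hy'), fun a ha => h.arr a fun ha' => ha (hA ha')⟩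

theorem writeIdx {X A : List ℕ} {s t : State} (h : Frame X A s t) {x : ℕ} (hx : x ∈ X) (n : ℕ) :
    Frame X A s (t.writeIdx x n) :=
  ⟨fun y hy => by
    rw [State.writeIdx_idx, if_neg (by rintro rfl; exact hy hx), h.idx y hy], h.arr⟩

theorem writeReal {X A : List ℕ} {s t : State} (h : Frame X A s t) {a : ℕ} (ha : a ∈ A)
    (i j : ℕ) (v : ℝ) : Frame X A s (t.writeReal a i j v) :=
  ⟨h.idx, fun b hb => by
    rw [State.writeReal_arr_of_ne _ (by rintro rfl; exact hb ha), h.arr b hb]⟩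

end Frame

namespace Prog

/-- `for x := 0 to (value of register N) - 1 do P`. -/
def forTo (x N : ℕ) (P : Prog) : Prog :=
  .seq (.setIdx x (.lit 0))
    (.loop (.not (.idxLE (.reg N) (.reg x))) (.seq P (.setIdx x (.add (.reg x) (.lit 1)))))

/-- Stores the sum of the values of `e` for `x = 0, …, (value of register N) - 1` in the entry
`(0, 0)` of array `A`. -/
def sumTo (x N A : ℕ) (e : RExp) : Prog :=
  .seq (.setReal A (.lit 0) (.lit 0) (.ofIdx (.lit 0)))
    (forTo x N (.setReal A (.lit 0) (.lit 0) (.add (.get A (.lit 0) (.lit 0)) e)))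

/-- Stores the values of `e` for `x = 0, …, (value of register N) - 1` in row `r` of array `A`. -/
def mapTo (x N A : ℕ) (r : IExp) (e : RExp) : Prog :=
  forTo x N (.setReal A r (.reg x) e)

end Prog

namespace Achieves

/-- A round costs `B` for the body, 4 for the guard and 4 for the increment; the initial assignment
and the last, failing guard account for the 6. The invariant is demanded after the increment of `x`,
so that it speaks of the state in which the next guard is evaluated. Carrying `k ≤ n` along forces
`k = n` at the exit. -/
theorem forTo {x N n B : ℕ} {P : Prog} {I : ℕ → State → Prop} {s : State} (hxN : N ≠ x)
    (hN : s.idx N = n) (h0 : I 0 (s.writeIdx x 0))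
    (hstep : ∀ k < n, ∀ t, I k t → t.idx x = k → t.idx N = n →
      Achieves P t B (fun t' => t'.idx x = k ∧ t'.idx N = n ∧ I (k + 1) (t'.writeIdx x (k + 1)))) :
    Achieves (.forTo x N P) s (n * (B + 8) + 6) (I n) := by
  have hl := loop (b := .not (.idxLE (.reg N) (.reg x)))
    (P := .seq P (.setIdx x (.add (.reg x) (.lit 1))))
    (I := fun k t => k ≤ n ∧ t.idx x = k ∧ t.idx N = n ∧ I k t) (N := n) (B := B + 4)
    (s := s.writeIdx x 0) (by
      rintro k t ⟨hk, hx, hn, hI⟩ hb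
      simp only [Test.Holds, IExp.eval, hx, hn, not_le] at hb
      refine ⟨hb, (hstep k hb t hI hx hn).seq fun t' ht' => setIdx (by simp [IExp.cost]) ?_⟩
      obtain ⟨h1, h2, h3⟩ := ht'
      refine ⟨hb, ?_, ?_, ?_⟩ <;> simp [IExp.eval, h1, h2, h3, hxN]) ⟨Nat.zero_le _, by simp, by simp [hxN, hN], h0⟩
  have hs : Achieves (.setIdx x (.lit 0)) s 2 (fun t => t = s.writeIdx x 0) :=
    setIdx (by simp [IExp.cost]) rfl
  refine (hs.seq (Q' := I n) (B' := n * (B + 8) + 4) fun t ht => ?_).mono (by omega)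
    fun t ht => ht
  subst ht
  refine hl.mono (le_of_eq (by simp [Test.cost, IExp.cost])) ?_
  rintro t ⟨hb, k, hk, -, hx, hn, hI⟩
  simp only [Test.Holds, IExp.eval, hx, hn, not_not] at hb
  obtain rfl : k = n := le_antisymm hk hb
  exact hI

theorem sumTo {x N n A : ℕ} {e : RExp} {s : State} (f : ℕ → ℝ) (hxN : N ≠ x) (hN : s.idx N = n)
    (hf : ∀ k < n, ∀ t, Frame [x] [A] s t → t.idx x = k → e.eval t = f k) :
    Achieves (.sumTo x N A e) s (n * (e.cost + 15) + 11)
      (fun t => Frame [x] [A] s t ∧ t.arr A 0 0 = ∑ k ∈ Finset.range n, f k) := by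
  have hs : Achieves (.setReal A (.lit 0) (.lit 0) (.ofIdx (.lit 0))) s 5
      (fun t => t = s.writeReal A 0 0 0) :=
    setReal (by simp [IExp.cost, RExp.cost]) (by simp [IExp.eval, RExp.eval])
  refine mono (hs.seq (B' := n * (e.cost + 15) + 6) (Q' := fun t => Frame [x] [A] s t ∧
    t.arr A 0 0 = ∑ k ∈ Finset.range n, f k) fun t ht => ?_) (by omega) fun t ht => ht
  subst ht
  refine forTo (B := e.cost + 7)
    (I := fun k t => Frame [x] [A] s t ∧ t.arr A 0 0 = ∑ i ∈ Finset.range k, f i)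
    hxN hN ⟨((Frame.refl _ _ _).writeReal (by simp) _ _ _).writeIdx (by simp) _, by simp⟩ ?_
  rintro k hk t ⟨hF, ht⟩ hx hn
  refine setReal (by simp [RExp.cost, IExp.cost]; omega) ⟨hx, hn, ?_, ?_⟩
  · exact (hF.writeReal (by simp) _ _ _).writeIdx (by simp) _
  · simp [RExp.eval, IExp.eval, ht, hf k hk t hF hx, Finset.sum_range_succ]

/-- The premise `hf` may use that the entries of the row from column `k` on are still the old ones;
this permits updates in place, where `e` reads the entry that is about to be overwritten. -/
theorem mapTo {x N n A r₀ : ℕ} {r : IExp} {e : RExp} {s : State} (f : ℕ → ℝ) (hxN : N ≠ x)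
    (hN : s.idx N = n) (hr : ∀ t, Frame [x] [A] s t → r.eval t = r₀)
    (hf : ∀ k < n, ∀ t, Frame [x] [A] s t → t.idx x = k →
      (∀ j, k ≤ j → t.arr A r₀ j = s.arr A r₀ j) → e.eval t = f k) :
    Achieves (.mapTo x N A r e) s (n * (r.cost + e.cost + 10) + 6)
      (fun t => Frame [x] [A] s t ∧
        t.arr A = fun i j => if i = r₀ ∧ j < n then f j else s.arr A i j) := by
  refine (forTo (B := r.cost + e.cost + 2)
    (I := fun k t => Frame [x] [A] s t ∧
      t.arr A = fun i j => if i = r₀ ∧ j < k then f j else s.arr A i j)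
    hxN hN ⟨(Frame.refl _ _ _).writeIdx (by simp) _, by simp⟩ ?_).mono
      (le_of_eq (by ring)) (fun t ht => ht)
  rintro k hk t ⟨hF, ht⟩ hx hn
  refine setReal (by simp [IExp.cost]; omega) ⟨hx, hn, ?_, ?_⟩
  · exact (hF.writeReal (by simp) _ _ _).writeIdx (by simp) _
  · have hv := hf k hk t hF hx fun j hj => by simp [ht, not_lt.2 hj]
    funext i j
    simp only [State.writeIdx_arr, State.writeReal_arr, hv, hr t hF, IExp.eval, hx, true_and, ht]
    by_cases h1 : i = r₀ <;> by_cases h2 : j = k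
    · simp [h1, h2]
    · have : j < k + 1 ↔ j < k := by omega
      simp [h1, h2, this]
    · simp [h1]
    · simp [h1]

end Achieves

end RealRAM

/-! ### Cuts of ellipsoids and volume arguments -/

section Euclidean

open MeasureTheory Module

variable {E : Type*} [NormedAddCommGroup E] [InnerProductSpace ℝ E]

/-- The ellipsoid with center `a` spanned by the linear map `A`. -/
def ellipsoid (A : E →ₗ[ℝ] E) (a : E) : Set E := {y | ∃ x : E, ‖x‖ ≤ 1 ∧ y = a + A x}

/-- Every point of a half ball lies in a slightly flattened ellipsoid. -/
theorem exists_norm_le_one_of_mem_halfBall {v x : E} (hv : ‖v‖ = 1) (hx : ‖x‖ ≤ 1)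
    (hvx : inner ℝ v x ≤ 0) {α : ℝ} (h0 : 0 < α) (h1 : α ≤ 1 / 4) :
    ∃ x' : E, ‖x'‖ ≤ 1 ∧
      x + α • v = (1 + α ^ 2) • x' - ((α + α ^ 2) * inner ℝ v x') • v := by
  have hβ : (0 : ℝ) < 1 + α ^ 2 := by positivity
  have hα : (0 : ℝ) < 1 - α := by linarith
  obtain ⟨b, hb⟩ : ∃ b : E, b = x - inner ℝ v x • v := ⟨_, rfl⟩
  obtain ⟨r, hr⟩ : ∃ r : ℝ, r = inner ℝ v x := ⟨_, rfl⟩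
  have hvv : inner ℝ v v = (1 : ℝ) := by rw [real_inner_self_eq_norm_sq, hv]; norm_num
  have hvb : inner ℝ v b = (0 : ℝ) := by
    rw [hb, inner_sub_right, inner_smul_right, hvv]; ring
  have hxb : x = b + r • v := by rw [hb, hr]; abel
  have hn : ∀ s t : ℝ, ‖s • b + t • v‖ ^ 2 = s ^ 2 * ‖b‖ ^ 2 + t ^ 2 := by
    intro s t
    rw [norm_add_sq_real, norm_smul, norm_smul, inner_smul_left, inner_smul_right,
      real_inner_comm, hvb, hv, mul_pow, mul_pow]
    simp
  have hbr : ‖b‖ ^ 2 + r ^ 2 ≤ 1 := by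
    have := hn 1 r
    rw [one_smul, ← hxb] at this
    nlinarith [norm_nonneg x]
  have hr0 : r ≤ 0 := hr ▸ hvx
  have hr1 : -1 ≤ r := by nlinarith [sq_nonneg ‖b‖]
  -- Solving the equation for `x'` componentwise: the flattened ellipsoid has semi-axis `1 - α`
  -- along `v` and `1 + α²` across.
  refine ⟨(1 + α ^ 2)⁻¹ • b + ((r + α) / (1 - α)) • v, ?_, ?_⟩
  · rw [← sq_le_one_iff₀ (norm_nonneg _), hn]
    -- The difference `(1-2α)(1+α²)² - (1-α)²` equals `α²(1-4α) + α⁴(1-2α)`; this is where `α ≤ 1/4`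
    -- enters.
    have h3 : ((1 + α ^ 2)⁻¹) ^ 2 ≤ (1 - 2 * α) / (1 - α) ^ 2 := by
      rw [inv_pow, inv_le_comm₀ (by positivity) (by apply div_pos <;> nlinarith), inv_div,
        div_le_iff₀ (by linarith)]
      nlinarith [mul_nonneg h0.le (sub_nonneg.2 h1), pow_pos h0 3, pow_pos h0 2, pow_pos h0 4,
        mul_nonneg (pow_pos h0 2).le (sub_nonneg.2 h1), mul_nonneg (pow_pos h0 3).le (sub_nonneg.2 h1),
        mul_nonneg (pow_pos h0 4).le (sub_nonneg.2 h1)]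
    calc ((1 + α ^ 2)⁻¹) ^ 2 * ‖b‖ ^ 2 + ((r + α) / (1 - α)) ^ 2
        ≤ (1 - 2 * α) / (1 - α) ^ 2 * (1 - r ^ 2) + ((r + α) / (1 - α)) ^ 2 := by
          gcongr
          · apply div_nonneg <;> nlinarith
          · linarith
      _ = ((1 - 2 * α) * (1 - r ^ 2) + (r + α) ^ 2) / (1 - α) ^ 2 := by
          rw [div_pow]; ring
      _ ≤ 1 := by
          rw [div_le_one (by positivity)]
          -- The numerator is `(1-α)² + 2α·r(1+r)`, and `-1 ≤ r ≤ 0`.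
          nlinarith [mul_nonneg h0.le (mul_nonneg (neg_nonneg.2 hr0) (by linarith : 0 ≤ 1 + r))]
  · have h4 : inner ℝ v ((1 + α ^ 2)⁻¹ • b + ((r + α) / (1 - α)) • v) = (r + α) / (1 - α) := by
      rw [inner_add_right, inner_smul_right, inner_smul_right, hvb, hvv]; ring
    rw [h4, hxb, smul_add, smul_smul, mul_inv_cancel₀ hβ.ne', one_smul, smul_smul, add_assoc,
      add_sub_assoc, ← add_smul, ← sub_smul]
    congr 2
    field_simp
    ring

/-- The linear map that spans the ellipsoid obtained from the one spanned by `A` by a cut through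
its center; `u` is the image of the normal vector of the cut under the adjoint of `A`. -/
noncomputable def cutMap (A : E →ₗ[ℝ] E) (u : E) (α : ℝ) : E →ₗ[ℝ] E :=
  (1 + α ^ 2) • A ∘ₗ LinearMap.transvection
    ((-(α + α ^ 2) / ((1 + α ^ 2) * ‖u‖ ^ 2)) • (innerₛₗ ℝ u)) u

theorem cutMap_apply (A : E →ₗ[ℝ] E) (u : E) (α : ℝ) (x : E) :
    cutMap A u α x = (1 + α ^ 2) • A x - ((α + α ^ 2) * inner ℝ u x / ‖u‖ ^ 2) • A u := by
  have : (1 + α ^ 2 : ℝ) ≠ 0 := by positivity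
  simp only [cutMap, LinearMap.smul_apply, LinearMap.comp_apply, LinearMap.transvection.apply,
    map_add, map_smul, smul_add, smul_smul, innerₛₗ_apply_apply, smul_eq_mul]
  rw [sub_eq_add_neg, ← neg_smul]
  congr 2
  field_simp

/-- Pulled back by `A`, the half-space with normal `g` through the center `a` becomes the half-space
with normal `u` through the origin, so the statement for the unit ball applies with `v = u / ‖u‖`.
-/
theorem subset_ellipsoid_cutMap {A : E →ₗ[ℝ] E} {a g u : E} (hu : ∀ x, inner ℝ u x = inner ℝ g (A x))
    (hu0 : u ≠ 0) {α : ℝ} (h0 : 0 < α) (h1 : α ≤ 1 / 4) {T : Set E} (hT : T ⊆ ellipsoid A a)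
    (hg : ∀ y ∈ T, inner ℝ g (y - a) ≤ 0) :
    T ⊆ ellipsoid (cutMap A u α) (a - (α / ‖u‖) • A u) := by
  intro y hy
  obtain ⟨x, hx, rfl⟩ := hT hy
  have hn : 0 < ‖u‖ := norm_pos_iff.2 hu0
  have hgx := hg _ hy
  rw [add_sub_cancel_left, ← hu] at hgx
  obtain ⟨x', hx', h⟩ := exists_norm_le_one_of_mem_halfBall (v := ‖u‖⁻¹ • u) (x := x)
    (by rw [norm_smul, norm_inv, norm_norm, inv_mul_cancel₀ hn.ne']) hx
    (by rw [inner_smul_left]; exact mul_nonpos_of_nonneg_of_nonpos (by simp) hgx) h0 h1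
  refine ⟨x', hx', ?_⟩
  have h2 := congrArg A h
  simp only [map_add, map_sub, map_smul] at h2
  rw [cutMap_apply]
  have h3 : A x = (1 + α ^ 2) • A x' - ((α + α ^ 2) * inner ℝ (‖u‖⁻¹ • u) x') • ‖u‖⁻¹ • A u
      - α • ‖u‖⁻¹ • A u := by rw [← h2]; abel
  rw [h3, inner_smul_left]
  simp only [smul_smul, conj_trivial]
  have e1 : (α + α ^ 2) * (‖u‖⁻¹ * inner ℝ u x') * ‖u‖⁻¹ = (α + α ^ 2) * inner ℝ u x' / ‖u‖ ^ 2 := by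
    field_simp
  rw [e1, ← div_eq_mul_inv]
  abel

/-- The transvection has determinant `1 - (α+α²)/(1+α²) = (1-α)/(1+α²)`, which takes one factor from
the power of `1 + α²` contributed by the scaling. -/
theorem det_cutMap [FiniteDimensional ℝ E] (A : E →ₗ[ℝ] E) {u : E} (hu0 : u ≠ 0) (α : ℝ)
    (hd : 0 < finrank ℝ E) :
    LinearMap.det (cutMap A u α) =
      (1 + α ^ 2) ^ (finrank ℝ E - 1) * (1 - α) * LinearMap.det A := by
  have hn : ‖u‖ ≠ 0 := norm_ne_zero_iff.2 hu0
  have hβ : (1 + α ^ 2 : ℝ) ≠ 0 := by positivity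
  obtain ⟨k, hk⟩ : ∃ k, finrank ℝ E = k + 1 := ⟨_, (Nat.succ_pred_eq_of_pos hd).symm⟩
  rw [cutMap, LinearMap.det_smul, LinearMap.det_comp, LinearMap.transvection.det, hk]
  simp only [LinearMap.smul_apply, innerₛₗ_apply_apply, real_inner_self_eq_norm_sq, smul_eq_mul,
    Nat.add_sub_cancel]
  rw [pow_succ]
  field_simp
  ring

/-- With `x = 1/(4d)`, the left side is at most `exp(d·x²)·exp(-x) = exp(-3x/4) ≤ 1 - x/2`. Since
`x/2 = d·(1/(8d²))`, Bernoulli's inequality finishes. Writing the bound as a `d`-th power lets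
volumes be compared as radii. -/
theorem cut_factor_le {d : ℕ} (hd : 0 < d) :
    (1 + (1 / (4 * d) : ℝ) ^ 2) ^ (d - 1) * (1 - 1 / (4 * d)) ≤ (1 - 1 / (8 * (d * d))) ^ d := by
  have hd1 : (1 : ℝ) ≤ d := by exact_mod_cast hd
  have hd0 : (d : ℝ) ≠ 0 := by positivity
  obtain ⟨x, hx⟩ : ∃ x : ℝ, x = 1 / (4 * d) := ⟨_, rfl⟩
  have hx0 : 0 < x := by rw [hx]; positivity
  have hxd : d * x = 1 / 4 := by rw [hx]; field_simp
  have hx1 : x ≤ 1 / 4 := by nlinarith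
  have h1 : (1 + x ^ 2) ^ (d - 1) ≤ Real.exp (x / 4) := by
    calc (1 + x ^ 2) ^ (d - 1) ≤ (1 + x ^ 2) ^ d :=
          pow_le_pow_right₀ (by nlinarith) (Nat.sub_le _ _)
      _ ≤ (Real.exp (x ^ 2)) ^ d := by
          gcongr
          linarith [Real.add_one_le_exp (x ^ 2)]
      _ = Real.exp (x / 4) := by
          rw [← Real.exp_nat_mul]
          congr 1
          linear_combination x * hxd
  have h2 : 1 - x ≤ Real.exp (-x) := by linarith [Real.add_one_le_exp (-x)]
  have h3 : Real.exp (-(3 * x / 4)) ≤ 1 - x / 2 := by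
    rw [Real.exp_neg, inv_le_comm₀ (Real.exp_pos _) (by linarith)]
    refine le_trans ?_ (Real.add_one_le_exp _)
    rw [inv_le_iff_one_le_mul₀ (by linarith)]
    nlinarith
  have h4 : 1 - x / 2 ≤ (1 - 1 / (8 * (d * d)) : ℝ) ^ d := by
    have h5 : (1 / (8 * (d * d)) : ℝ) ≤ 1 := by
      rw [div_le_one (by positivity)]; nlinarith
    have := one_add_mul_le_pow (a := -(1 / (8 * (d * d)) : ℝ)) (by linarith) d
    rw [← sub_eq_add_neg] at this
    refine le_trans (le_of_eq ?_) this
    rw [hx]; field_simp; ring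
  rw [← hx]
  calc (1 + x ^ 2) ^ (d - 1) * (1 - x) ≤ Real.exp (x / 4) * Real.exp (-x) := by
        gcongr; linarith
    _ = Real.exp (-(3 * x / 4)) := by rw [← Real.exp_add]; congr 1; ring
    _ ≤ _ := h3.trans h4

/-- Comparison of Haar measures, divided by the measure of the unit ball. -/
theorem pow_le_abs_det_of_closedBall_subset_ellipsoid [FiniteDimensional ℝ E] {A : E →ₗ[ℝ] E}
    {a y : E} {ρ : ℝ} (hρ : 0 ≤ ρ) (h : Metric.closedBall y ρ ⊆ ellipsoid A a) :
    ρ ^ finrank ℝ E ≤ |LinearMap.det A| := by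
  borelize E
  let μ : Measure E := Measure.addHaar
  have h1 : ellipsoid A a = (fun x => a + x) '' (A '' Metric.closedBall 0 1) := by
    ext z
    simp only [ellipsoid, Set.mem_ofPred_eq, Set.mem_image, Metric.mem_closedBall, dist_zero_right]
    constructor
    · rintro ⟨x, hx, rfl⟩; exact ⟨_, ⟨x, hx, rfl⟩, rfl⟩
    · rintro ⟨_, ⟨x, hx, rfl⟩, rfl⟩; exact ⟨x, hx, rfl⟩
  have h2 : μ (Metric.closedBall y ρ) ≤ μ (ellipsoid A a) := measure_mono h
  rw [h1, Set.image_add_left, measure_preimage_add, μ.addHaar_image_linearMap,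
    μ.addHaar_closedBall' y hρ] at h2
  have h3 := (ENNReal.mul_le_mul_iff_left (Metric.measure_closedBall_pos μ 0 zero_lt_one).ne'
    measure_closedBall_lt_top.ne).1 h2
  exact (ENNReal.ofReal_le_ofReal_iff (abs_nonneg _)).1 h3

/-- Packing: points at mutual distance at least `2 * ρ` in a ball of radius `R`. -/
theorem card_mul_pow_le_of_separated [FiniteDimensional ℝ E] {m : ℕ} {q : Fin m → E} {p : E}
    {ρ R : ℝ} (hρ : 0 < ρ) (hR : 0 ≤ R) (hq : ∀ i, dist (q i) p ≤ R)
    (hsep : ∀ i j, i ≠ j → 2 * ρ ≤ dist (q i) (q j)) :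
    m * ρ ^ finrank ℝ E ≤ (R + ρ) ^ finrank ℝ E := by
  borelize E
  let μ : Measure E := Measure.addHaar
  have hD : Pairwise (Function.onFun Disjoint fun i => Metric.ball (q i) ρ) := fun i j hij =>
    Metric.ball_disjoint_ball (by linarith [hsep i j hij])
  have hsub : (⋃ i, Metric.ball (q i) ρ) ⊆ Metric.ball p (R + ρ) :=
    Set.iUnion_subset fun i => Metric.ball_subset_ball' (by linarith [hq i])
  have h := measure_mono (μ := μ) hsub
  rw [measure_iUnion hD fun i => measurableSet_ball, μ.addHaar_ball_of_pos p (by positivity)] at h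
  simp only [μ.addHaar_ball_of_pos _ hρ, tsum_fintype, Finset.sum_const, Finset.card_univ,
    Fintype.card_fin, nsmul_eq_mul, ← mul_assoc] at h
  have h3 := (ENNReal.mul_le_mul_iff_left (Metric.measure_ball_pos μ 0 zero_lt_one).ne'
    measure_ball_lt_top.ne).1 h
  have h4 := ENNReal.toReal_le_of_le_ofReal (by positivity) h3
  simpa [ENNReal.toReal_ofReal (pow_nonneg hρ.le _)] using h4

end Euclidean

/-! ### Voronoi cells, their neighbors and the ball of nearly optimal points -/

namespace VoronoiMesh
open Module

variable {d : ℕ}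

theorem dist_le_dist_iff_inner {E : Type*} [NormedAddCommGroup E] [InnerProductSpace ℝ E]
    (x p q : E) : dist x p ≤ dist x q ↔ 2 * inner ℝ (q - p) (x - p) ≤ ‖q - p‖ ^ 2 := by
  have h : dist x q ^ 2 = dist x p ^ 2 - 2 * inner ℝ (q - p) (x - p) + ‖q - p‖ ^ 2 := by
    rw [dist_eq_norm, dist_eq_norm, ← sub_sub_sub_cancel_right x q p, norm_sub_sq_real,
      real_inner_comm]
  rw [← sq_le_sq₀ dist_nonneg dist_nonneg, h]
  constructor <;> intro h' <;> linarith

/-- Common points of the two cells lie on the bisector, where the inner product with `q - p` is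
constant. -/
theorem vectorSpan_inter_voronoiCell_le {M : Finset (Pt d)} {p q : Pt d} (hp : p ∈ M) (hq : q ∈ M) :
    vectorSpan ℝ (voronoiCell M p ∩ voronoiCell M q) ≤ (ℝ ∙ (q - p))ᗮ := by
  have hz : ∀ x ∈ voronoiCell M p ∩ voronoiCell M q,
      2 * inner ℝ (q - p) (x - p) = ‖q - p‖ ^ 2 := fun x hx => by
    refine le_antisymm ((dist_le_dist_iff_inner x p q).1 (hx.1 q hq)) ?_
    by_contra! hlt
    have h1 := hx.2 p hp
    have h2 := (dist_le_dist_iff_inner x q p).1 h1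
    have h3 : inner ℝ (p - q) (x - q) = ‖q - p‖ ^ 2 - inner ℝ (q - p) (x - p) := by
      rw [← neg_sub q p, inner_neg_left, ← sub_sub_sub_cancel_right x q p, inner_sub_right,
        real_inner_self_eq_norm_sq]
      ring
    rw [h3, norm_sub_rev p q] at h2
    linarith
  rw [vectorSpan_def, Submodule.span_le]
  rintro _ ⟨x, hx, y, hy, rfl⟩
  rw [SetLike.mem_coe, Submodule.mem_orthogonal_singleton_iff_inner_right]
  have hxy : x -ᵥ y = (x - p) - (y - p) := by simp
  change inner ℝ (q - p) (x -ᵥ y) = 0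
  rw [hxy, inner_sub_right]
  linarith [hz x hx, hz y hy]

/-- A Voronoi cell is bounded by the bisectors of the Delaunay edges. -/
theorem mem_voronoiCell_of_forall_delaunayEdge {M : Finset (Pt d)} {p x : Pt d} (hp : p ∈ M)
    (hx : ∀ q, DelaunayEdge M p q → dist x p ≤ dist x q) : x ∈ voronoiCell M p := by
  classical
  -- Among the sets of sites whose bisectors with `p` cut out the cell, a minimal one is chosen;
  -- each of its members will turn out to be a Delaunay neighbor.
  let good : Finset (Pt d) → Prop := fun S =>
    S ⊆ M.erase p ∧ ∀ y, (∀ q ∈ S, dist y p ≤ dist y q) → y ∈ voronoiCell M p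
  have hgood : good (M.erase p) := by
    refine ⟨subset_rfl, fun y hy q hq => ?_⟩
    by_cases h : q = p
    · rw [h]
    · exact hy q (Finset.mem_erase.2 ⟨h, hq⟩)
  obtain ⟨S, hS, hmin⟩ := exists_minimal_of_wellFoundedLT good ⟨_, hgood⟩
  refine hS.2 x fun q hq => hx q ?_
  have hqM := Finset.mem_erase.1 (hS.1 hq)
  have hnot : ¬ good (S.erase q) := fun h =>
    (Finset.notMem_erase q S) (hmin h (Finset.erase_subset q S) hq)
  -- By minimality, dropping `q` admits a point `y` outside the cell; it can violate only the
  -- bisector of `q`.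
  obtain ⟨y, hy, hyV⟩ : ∃ y, (∀ q' ∈ S.erase q, dist y p ≤ dist y q') ∧ y ∉ voronoiCell M p := by
    by_contra! h
    exact hnot ⟨(Finset.erase_subset q S).trans hS.1, h⟩
  have hyq : ‖q - p‖ ^ 2 < 2 * inner ℝ (q - p) (y - p) := by
    by_contra! h
    refine hyV (hS.2 y fun q' hq' => ?_)
    by_cases hqq : q' = q
    · rw [hqq]; exact (dist_le_dist_iff_inner y p q).2 h
    · exact hy q' (Finset.mem_erase.2 ⟨hqq, hq'⟩)
  have hpos : ∀ q' ∈ S, 0 < ‖q' - p‖ ^ 2 := fun q' hq' => by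
    have := norm_pos_iff.2 (sub_ne_zero.2 (Finset.mem_erase.1 (hS.1 hq')).1)
    positivity
  have hqpos := hpos q hq
  -- The segment from `p` to `y` crosses the bisector of `q` at parameter `t < 1`. There the other
  -- constraints are strict, because they are strict at `p` and hold at `y`.
  obtain ⟨t, ht⟩ : ∃ t : ℝ, t = ‖q - p‖ ^ 2 / (2 * inner ℝ (q - p) (y - p)) := ⟨_, rfl⟩
  have ht0 : 0 < t := by rw [ht]; exact div_pos hqpos (hqpos.trans hyq)
  have ht1 : t < 1 := by rw [ht, div_lt_one (hqpos.trans hyq)]; exact hyq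
  have htq : t * (2 * inner ℝ (q - p) (y - p)) = ‖q - p‖ ^ 2 := by
    rw [ht, div_mul_cancel₀ _ (hqpos.trans hyq).ne']
  -- By strictness, a small move within the bisector stays in both cells; so the common face spans
  -- all directions orthogonal to `q - p`.
  have hface : ∀ v : Pt d, inner ℝ (q - p) v = 0 → ∃ s : ℝ, 0 < s ∧
      p + (t • (y - p) + s • v) ∈ voronoiCell M p ∩ voronoiCell M q := by
    intro v hv
    have hev : ∀ᶠ s : ℝ in nhdsWithin 0 (Set.Ioi 0), ∀ q' ∈ S.erase q,
        2 * inner ℝ (q' - p) (t • (y - p) + s • v) < ‖q' - p‖ ^ 2 := by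
      refine (Filter.eventually_all_finset _).2 fun q' hq' => ?_
      have hc : Continuous fun s : ℝ => 2 * inner ℝ (q' - p) (t • (y - p) + s • v) := by fun_prop
      refine Filter.Eventually.filter_mono nhdsWithin_le_nhds
        (hc.continuousAt.eventually_lt continuousAt_const ?_)
      have h1 := (dist_le_dist_iff_inner y p q').1 (hy q' hq')
      have h2 := hpos q' (Finset.mem_of_mem_erase hq')
      rw [zero_smul, add_zero, inner_smul_right]
      nlinarith
    obtain ⟨s, hs, hs0⟩ := (hev.and self_mem_nhdsWithin).exists
    have hzq : 2 * inner ℝ (q - p) (t • (y - p) + s • v) = ‖q - p‖ ^ 2 := by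
      rw [inner_add_right, inner_smul_right, inner_smul_right, hv, ← htq]; ring
    have hzp : p + (t • (y - p) + s • v) ∈ voronoiCell M p := by
      refine hS.2 _ fun q' hq' => (dist_le_dist_iff_inner _ _ _).2 ?_
      rw [add_sub_cancel_left]
      by_cases hqq : q' = q
      · rw [hqq, hzq]
      · exact (hs q' (Finset.mem_erase.2 ⟨hqq, hq'⟩)).le
    refine ⟨s, hs0, hzp, fun q' hq' => le_trans ?_ (hzp q' hq')⟩
    rw [dist_le_dist_iff_inner, ← neg_sub q p, ← sub_sub_sub_cancel_right _ q p,
      add_sub_cancel_left, inner_neg_left, inner_sub_right, real_inner_self_eq_norm_sq, norm_neg]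
    linarith
  obtain ⟨s₀, -, h₀⟩ := hface 0 (inner_zero_right _)
  rw [smul_zero, add_zero] at h₀
  refine ⟨hp, hqM.2, hqM.1.symm, ⟨_, h₀⟩, ?_⟩
  have hspan : vectorSpan ℝ (voronoiCell M p ∩ voronoiCell M q) = (ℝ ∙ (q - p))ᗮ := by
    refine le_antisymm (vectorSpan_inter_voronoiCell_le hp hqM.2) fun v hv => ?_
    rw [Submodule.mem_orthogonal_singleton_iff_inner_right] at hv
    obtain ⟨s, hs, h⟩ := hface v hv
    have hm := vsub_mem_vectorSpan ℝ h h₀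
    have : (p + (t • (y - p) + s • v)) -ᵥ (p + t • (y - p)) = s • v := by
      rw [vsub_eq_sub]; abel
    rw [this] at hm
    exact (Submodule.smul_mem_iff _ hs.ne').1 hm
  have h1 := (ℝ ∙ (q - p)).finrank_add_finrank_orthogonal
  rw [finrank_span_singleton (sub_ne_zero.2 hqM.1), finrank_euclideanSpace_fin] at h1
  rw [hspan]; omega

theorem convex_voronoiCell (M : Finset (Pt d)) (p : Pt d) : Convex ℝ (voronoiCell M p) := by
  intro x hx y hy a b ha hb hab q hq
  have h1 := (dist_le_dist_iff_inner x p q).1 (hx q hq)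
  have h2 := (dist_le_dist_iff_inner y p q).1 (hy q hq)
  rw [dist_le_dist_iff_inner]
  have : a • x + b • y - p = a • (x - p) + b • (y - p) := by
    obtain rfl : b = 1 - a := by linarith
    module
  rw [this, inner_add_right, inner_smul_right, inner_smul_right]
  nlinarith [mul_le_mul_of_nonneg_left h1 ha, mul_le_mul_of_nonneg_left h2 hb]

theorem inradius_le_half_dist {M : Finset (Pt d)} {u q : Pt d} (hq : q ∈ M) (h : q ≠ u) :
    2 * inradius M u ≤ dist u q := by
  have : Metric.infDist u ((M : Set (Pt d)) \ {u}) ≤ dist u q :=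
    Metric.infDist_le_dist_of_mem ⟨hq, h⟩
  rw [inradius]; linarith

theorem closedBall_inradius_subset_voronoiCell {M : Finset (Pt d)} {p : Pt d} :
    Metric.closedBall p (inradius M p) ⊆ voronoiCell M p := by
  intro x hx q hq
  by_cases h : q = p
  · rw [h]
  · have h1 := inradius_le_half_dist hq h
    have h2 := dist_triangle_left p q x
    rw [Metric.mem_closedBall] at hx
    linarith

theorem dist_corner_le {M : Finset (Pt d)} {τ : ℝ} (hτ : 0 ≤ τ) (hM : IsWellSpaced M τ) {p w : Pt d}
    (hp : p ∈ M) (hr : 0 < inradius M p) (hw : w ∈ corners M p) :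
    dist p w ≤ τ * inradius M p := by
  have h := hM p hp
  rw [aspectRatio, ENNReal.div_le_iff (by simpa using hr) ENNReal.ofReal_ne_top,
    ← ENNReal.ofReal_mul hτ] at h
  have h2 : edist p w ≤ outradius M p := le_iSup₂_of_le w hw le_rfl
  rw [edist_dist] at h2
  exact (ENNReal.ofReal_le_ofReal_iff (by positivity)).1 (h2.trans h)

section Neighbors

variable {M : Finset (Pt d)} {τ : ℝ} {G : SimpleGraph (Pt d)} {p : Pt d} {m : ℕ} {q : Fin m → Pt d}

theorem dist_neighbor_le (hG : IsApproxDelaunayGraph M τ G) (hτ : 0 ≤ τ)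
    (hq : Set.range q = G.neighborSet p) (i : Fin m) :
    dist p (q i) ≤ 2 * τ * inradius M p ∧ dist p (q i) ≤ 2 * τ * inradius M (q i) ∧
      2 * inradius M p ≤ dist p (q i) ∧ q i ∈ M ∧ q i ≠ p := by
  have hadj : G.Adj p (q i) := by
    have : q i ∈ G.neighborSet p := hq ▸ Set.mem_range_self i
    exact this
  have h := hG.pruned _ _ hadj
  have hm := (hG.mem _ _ hadj).2
  refine ⟨h.trans ?_, h.trans ?_, inradius_le_half_dist hm hadj.ne', hm, hadj.ne'⟩
  · exact mul_le_mul_of_nonneg_left (min_le_left _ _) (by linarith)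
  · exact mul_le_mul_of_nonneg_left (min_le_right _ _) (by linarith)

theorem mem_voronoiCell_of_forall_neighbor (hG : IsApproxDelaunayGraph M τ G) (hp : p ∈ M)
    (hq : Set.range q = G.neighborSet p) {x : Pt d} (hx : ∀ i, dist x p ≤ dist x (q i)) :
    x ∈ voronoiCell M p := by
  refine mem_voronoiCell_of_forall_delaunayEdge hp fun u hu => ?_
  have : u ∈ Set.range q := hq ▸ hG.delaunay _ _ hu
  obtain ⟨i, rfl⟩ := this
  exact hx i

/-- Without neighbors the cell would be the whole space, and `w + c` would beat `w`. -/
theorem card_neighbors_pos (hG : IsApproxDelaunayGraph M τ G) (hp : p ∈ M)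
    (hq : Set.range q = G.neighborSet p) {c w : Pt d} (hc : ‖c‖ = 1)
    (hw : IsFarthestCorner M p c w) : 0 < m := by
  rcases Nat.eq_zero_or_pos m with rfl | h
  · have h1 := hw.2 (w + c) (mem_voronoiCell_of_forall_neighbor hG hp hq fun i => i.elim0)
    rw [inner_add_left, real_inner_self_eq_norm_sq, hc] at h1
    linarith
  · exact h

theorem inradius_pos_of_neighbor (hG : IsApproxDelaunayGraph M τ G) (hτ : 0 < τ)
    (hq : Set.range q = G.neighborSet p) (i : Fin m) : 0 < inradius M p := by
  obtain ⟨h1, -, -, -, h2⟩ := dist_neighbor_le hG hτ.le hq i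
  have h3 := dist_pos.2 h2.symm
  by_contra! h
  nlinarith

/-- From `2·r(p) ≤ dist p qᵢ ≤ 2τ·r(qᵢ)` follows `r(qᵢ) ≥ r(p)/τ`. So neighbors have mutual distance
at least `2·r(p)/τ`, while all lie within `2τ·r(p)` of `p`. -/
theorem card_neighbors_le (hG : IsApproxDelaunayGraph M τ G) (hτ : 1 < τ)
    (hinj : Function.Injective q) (hq : Set.range q = G.neighborSet p)
    (hr : 0 < inradius M p) : (m : ℝ) ≤ (2 * τ ^ 2 + 1) ^ d := by
  have hτ0 : 0 < τ := by linarith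
  have h := card_mul_pow_le_of_separated (q := q) (p := p) (ρ := inradius M p / τ)
    (R := 2 * τ * inradius M p) (by positivity) (by positivity)
    (fun i => by rw [dist_comm]; exact (dist_neighbor_le hG hτ0.le hq i).1) (fun i j hij => by
      obtain ⟨-, h2, h3, -, -⟩ := dist_neighbor_le hG hτ0.le hq i
      obtain ⟨-, -, -, h4, -⟩ := dist_neighbor_le hG hτ0.le hq j
      have h5 := inradius_le_half_dist (u := q i) h4 (fun h => hij (hinj h).symm)
      rw [← mul_div_assoc, div_le_iff₀ hτ0]
      nlinarith)
  rw [finrank_euclideanSpace_fin] at h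
  have h2 : (2 * τ * inradius M p + inradius M p / τ) =
      (2 * τ ^ 2 + 1) * (inradius M p / τ) := by field_simp
  rw [h2, mul_pow] at h
  exact le_of_mul_le_mul_right h (by positivity)

/-- A ball of nearly optimal points of the Voronoi cell, not too small compared to the distance
between `p` and any neighbor `q i`. -/
theorem exists_closedBall_nearly_optimal (hM : IsWellSpaced M τ) (hG : IsApproxDelaunayGraph M τ G)
    (hp : p ∈ M) (hτ : 1 < τ) (hq : Set.range q = G.neighborSet p) {c w : Pt d} (hc : ‖c‖ = 1)
    (hw : IsFarthestCorner M p c w) {ε : ℝ} (h0 : 0 < ε) (h1 : ε < 1) (i : Fin m)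
    (hr : 0 < inradius M p) :
    ∃ y : Pt d, Metric.closedBall y (ε / (2 * τ ^ 2) * (τ * dist p (q i) / 2)) ⊆
      voronoiCell M p ∩ Metric.closedBall p (τ * dist p (q i) / 2) ∩
        {x | (1 - ε) * inner ℝ (w - p) c ≤ inner ℝ (x - p) c} := by
  have hτ0 : 0 < τ := by linarith
  obtain ⟨hd1, -, hd2, -, -⟩ := dist_neighbor_le hG hτ0.le hq i
  obtain ⟨r, hrr⟩ : ∃ r, r = inradius M p := ⟨_, rfl⟩
  rw [← hrr] at hr hd1 hd2
  have hwp : ‖w - p‖ ≤ τ * r := by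
    rw [← dist_eq_norm, dist_comm, hrr]; exact dist_corner_le hτ0.le hM hp (hrr ▸ hr) hw.1
  have hρ : ε / (2 * τ ^ 2) * (τ * dist p (q i) / 2) ≤ ε / 2 * r := by
    have : ε / (2 * τ ^ 2) * (τ * dist p (q i) / 2) = ε / (4 * τ) * dist p (q i) := by
      field_simp; ring
    rw [this]
    calc ε / (4 * τ) * dist p (q i) ≤ ε / (4 * τ) * (2 * τ * r) := by gcongr
      _ = ε / 2 * r := by field_simp; norm_num
  -- The inscribed ball reaches height `r` in the direction `c`, so moving down by `(ε/2)·r` loses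
  -- at most an `ε/2` share of the optimum.
  have hh : r ≤ inner ℝ (w - p) c := by
    have h2 := hw.2 (p + r • c) (closedBall_inradius_subset_voronoiCell (by
      rw [Metric.mem_closedBall, dist_self_add_left, norm_smul, hc, ← hrr, mul_one,
        Real.norm_of_nonneg hr.le]))
    rw [inner_add_left, inner_smul_left, real_inner_self_eq_norm_sq, hc] at h2
    rw [inner_sub_left]
    simp only [conj_trivial] at h2
    linarith
  -- The center of the image of the ball `B(p, r)` under the homothety with center `w` and ratio
  -- `ε/2`. Each `x` of the smaller ball is the image of some `p + e` with `‖e‖ ≤ r`, hence in the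
  -- cell by convexity.
  refine ⟨p + (1 - ε / 2) • (w - p), fun x hx => ?_⟩
  obtain ⟨e, he⟩ : ∃ e : Pt d, e = (2 / ε) • (x - (p + (1 - ε / 2) • (w - p))) := ⟨_, rfl⟩
  have hxe : x = p + (1 - ε / 2) • (w - p) + (ε / 2) • e := by
    rw [he, smul_smul]
    have : ε / 2 * (2 / ε) = 1 := by field_simp
    rw [this, one_smul]; abel
  have her : ‖e‖ ≤ r := by
    rw [Metric.mem_closedBall, dist_eq_norm] at hx
    rw [he, norm_smul, Real.norm_of_nonneg (by positivity)]
    calc 2 / ε * ‖x - (p + (1 - ε / 2) • (w - p))‖ ≤ 2 / ε * (ε / 2 * r) := by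
          gcongr; exact hx.trans hρ
      _ = r := by field_simp
  refine ⟨⟨?_, ?_⟩, ?_⟩
  · have h2 : p + e ∈ voronoiCell M p := closedBall_inradius_subset_voronoiCell (by
      rw [Metric.mem_closedBall, dist_self_add_left, ← hrr]; exact her)
    have h3 := convex_voronoiCell M p hw.1.1 h2 (by linarith : 0 ≤ 1 - ε / 2)
      (by linarith : 0 ≤ ε / 2) (by ring)
    rw [hxe]
    convert h3 using 1
    module
  · rw [Metric.mem_closedBall, dist_eq_norm, hxe, add_assoc, add_sub_cancel_left]
    calc ‖(1 - ε / 2) • (w - p) + (ε / 2) • e‖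
        ≤ (1 - ε / 2) * ‖w - p‖ + (ε / 2) * ‖e‖ := by
          refine (norm_add_le _ _).trans (le_of_eq ?_)
          rw [norm_smul, norm_smul, Real.norm_of_nonneg (by linarith),
            Real.norm_of_nonneg (by linarith)]
      _ ≤ (1 - ε / 2) * (τ * r) + (ε / 2) * (τ * r) := by
          have : r ≤ τ * r := by nlinarith
          gcongr
          · linarith
          · linarith
      _ = τ * r := by ring
      _ ≤ _ := by nlinarith
  · have h2 : -r ≤ inner ℝ e c := by
      have := abs_le.1 (abs_real_inner_le_norm e c)
      rw [hc, mul_one] at this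
      linarith
    rw [Set.mem_ofPred_eq, hxe, add_assoc, add_sub_cancel_left, inner_add_left, inner_smul_left,
      inner_smul_left]
    simp only [conj_trivial]
    nlinarith

end Neighbors

end VoronoiMesh

/-! ### The ellipsoid method as a program; effect and step count of its pieces -/

namespace RealRAM

/-- The natural number `n`. -/
abbrev RExp.nat (n : ℕ) : RExp := .ofIdx (.lit n)

/-- The entry `(0, 0)` of array `a`. -/
abbrev RExp.cell (a : ℕ) : RExp := .get a (.lit 0) (.lit 0)

/-- The entry of the first row of array `a` at the column in register `x`. -/
abbrev RExp.coord (a x : ℕ) : RExp := .get a (.lit 0) (.reg x)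

/-- The entry of array `a` at the row in register `x` and the column in register `y`. -/
abbrev RExp.entry (a x y : ℕ) : RExp := .get a (.reg x) (.reg y)

abbrev RExp.sq (e : RExp) : RExp := .mul e e

/-- For each value of register `x` below the one of register `N`, stores the sum of the values of
`e` for `y = 0, …, (value of register N) - 1` in the first row of array `A`. -/
def Prog.sumMapTo (x y N A : ℕ) (e : RExp) : Prog :=
  .forTo x N (.seq (.sumTo y N 9 e) (.setReal A (.lit 0) (.reg x) (.cell 9)))

/-- Array `9` is scratch space for the inner sums, whence `A ≠ 9`. -/
theorem Achieves.sumMapTo {x y N n A : ℕ} {e : RExp} {s : State} (f : ℕ → ℕ → ℝ) (hxN : N ≠ x)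
    (hyN : N ≠ y) (hxy : x ≠ y) (hA : A ≠ 9) (hN : s.idx N = n)
    (hf : ∀ i < n, ∀ j < n, ∀ t, Frame [x, y] [A, 9] s t → t.idx x = i → t.idx y = j →
      e.eval t = f i j) :
    Achieves (.sumMapTo x y N A e) s (n * (n * (e.cost + 15) + 25) + 6)
      (fun t => Frame [x, y] [A, 9] s t ∧
        ∀ i < n, t.arr A 0 i = ∑ j ∈ Finset.range n, f i j) := by
  refine (forTo (B := n * (e.cost + 15) + 11 + 6)
    (I := fun k t => Frame [x, y] [A, 9] s t ∧
      ∀ i < k, t.arr A 0 i = ∑ j ∈ Finset.range n, f i j)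
    hxN hN ⟨(Frame.refl _ _ _).writeIdx (by simp) _, by simp⟩ ?_).mono
      (le_of_eq (by ring)) (fun t ht => ht)
  rintro k hk t ⟨hF, ht⟩ hx hn
  refine (sumTo (f k) hyN hn fun j hj u hu huy => hf k hk j hj u
    (hF.trans (hu.mono (by simp) (by simp))) (by rw [hu.idx x (by simpa using hxy), hx]) huy).seq
    fun u ⟨hu, huv⟩ => ?_
  have hux : u.idx x = k := by rw [hu.idx x (by simpa using hxy), hx]
  refine setReal (by simp [RExp.cost, IExp.cost]) ⟨hux, ?_, ?_, ?_⟩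
  · rw [State.writeReal_idx, hu.idx N (by simpa using hyN), hn]
  · exact ((hF.trans (hu.mono (by simp) (by simp))).writeReal (by simp) _ _ _).writeIdx
      (by simp) _
  · intro i hi
    have hA' : A ∉ [9] := by simpa using hA
    simp only [State.writeIdx_arr, State.writeReal_arr, IExp.eval, RExp.eval, hux, true_and, huv]
    by_cases hik : i = k
    · simp [hik]
    · rw [if_neg hik, hu.arr A hA', ht i (by omega)]

end RealRAM

namespace VoronoiMesh
open RealRAM

/-- Arrays `5` and `6` hold the linear map and the center of the current ellipsoid, array `4` the
best point found so far, and array `11` a number that decreases geometrically. -/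
def initProg : Prog :=
  .seq (.sumTo 3 0 12 (.sq (.sub (.coord 3 3) (.coord 1 3))))
  (.seq (.mapTo 3 0 6 (.lit 0) (.coord 1 3))
  (.seq (.mapTo 3 0 4 (.lit 0) (.coord 1 3))
  (.seq (.forTo 2 0 (.setReal 5 (.reg 2) (.reg 2)
    (.div (.mul (.cell 0) (.sqrt (.cell 12))) (.nat 2))))
  (.setReal 11 (.lit 0) (.lit 0) (.nat 1)))))

/-- Stores the normal vector of a half-space to be cut off in array `7`; register `4` tells whether
the center violates the constraint of some neighbor. -/
def findCut : Prog :=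
  .seq (.mapTo 3 0 7 (.lit 0) (.sub (.nat 0) (.coord 2 3)))
  (.seq (.setIdx 4 (.lit 0))
  (.forTo 2 1
    (.seq (.sumTo 3 0 9 (.sub (.sq (.sub (.coord 6 3) (.entry 3 2 3)))
      (.sq (.sub (.coord 6 3) (.coord 1 3)))))
    (.branch (.realLE (.nat 0) (.cell 9)) .skip
      (.seq (.setIdx 4 (.lit 1))
        (.mapTo 3 0 7 (.lit 0) (.sub (.entry 3 2 3) (.coord 1 3))))))))

/-- Replaces the best point by the center if the latter lies in the cell and is not worse. -/
def recordBest : Prog :=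
  .branch (.idxLE (.reg 4) (.lit 0))
    (.seq (.sumTo 3 0 9 (.mul (.coord 2 3) (.sub (.coord 6 3) (.coord 4 3))))
      (.branch (.realLE (.nat 0) (.cell 9)) (.mapTo 3 0 4 (.lit 0) (.coord 6 3)) .skip))
    .skip

/-- The relative depth `1 / (4 * d)` of a cut. -/
def depthExp : RExp := .div (.nat 1) (.mul (.nat 4) (.ofIdx (.reg 0)))

/-- With `L` the matrix in array `5` and `g` the vector in array `7`, array `8` receives `u = Lᵀg`,
array `12` receives `‖u‖²`, and array `10` receives `Lu`, all before `L` is overwritten. -/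
def updateEllipsoid : Prog :=
  .seq (.sumMapTo 2 3 0 8 (.mul (.entry 5 3 2) (.coord 7 3)))
  (.seq (.sumTo 3 0 12 (.sq (.coord 8 3)))
  (.seq (.sumMapTo 2 3 0 10 (.mul (.entry 5 2 3) (.coord 8 3)))
  (.seq (.mapTo 3 0 6 (.lit 0)
    (.sub (.coord 6 3) (.mul (.div depthExp (.sqrt (.cell 12))) (.coord 10 3))))
  (.seq (.forTo 2 0 (.mapTo 3 0 5 (.reg 2)
    (.sub (.mul (.add (.nat 1) (.sq depthExp)) (.entry 5 2 3))
      (.mul (.div (.mul (.add depthExp (.sq depthExp)) (.coord 8 3)) (.cell 12)) (.coord 10 2)))))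
  (.setReal 11 (.lit 0) (.lit 0) (.mul (.cell 11) (.sub (.nat 1)
    (.div (.nat 1) (.mul (.nat 8) (.mul (.ofIdx (.reg 0)) (.ofIdx (.reg 0))))))))))))

/-- The ellipsoid method for the Voronoi cell. -/
def farthestPointProg : Prog :=
  .seq initProg
    (.loop (.realLE (.div (.get 0 (.lit 0) (.lit 1)) (.mul (.nat 2) (.sq (.cell 0)))) (.cell 11))
      (.seq (.seq findCut recordBest) updateEllipsoid))

/-- Array `12` receives the squared distance between `p` and the first neighbor, row `0` of array
`3`. Only the diagonal of array `5` is written, so the array has to be zero at the start. -/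
theorem achieves_initProg {s : State} {d : ℕ} (hd : s.idx 0 = d) (h5 : s.arr 5 = fun _ _ => 0) :
    Achieves initProg s (200 * (d + 1)) (fun t => Frame [2, 3] [4, 5, 6, 11, 12] s t ∧
      (∀ j < d, t.arr 6 0 j = s.arr 1 0 j) ∧ (∀ j < d, t.arr 4 0 j = s.arr 1 0 j) ∧
      (∀ i < d, ∀ j < d, t.arr 5 i j = if i = j then s.arr 0 0 0 *
        √(∑ j ∈ Finset.range d, (s.arr 3 0 j - s.arr 1 0 j) ^ 2) / 2 else 0) ∧
      t.arr 11 0 0 = 1) := by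
  obtain ⟨S, hS⟩ : ∃ S, S = ∑ j ∈ Finset.range d, (s.arr 3 0 j - s.arr 1 0 j) ^ 2 := ⟨_, rfl⟩
  rw [← hS]
  have h1 := Achieves.sumTo (x := 3) (N := 0) (A := 12) (s := s)
    (e := .sq (.sub (.coord 3 3) (.coord 1 3)))
    (fun j => (s.arr 3 0 j - s.arr 1 0 j) ^ 2) (by simp) hd (fun k hk t hF hk => by
      simp [RExp.eval, IExp.eval, hF.arr, hk, pow_two])
  refine h1.seqOf (by simp [RExp.cost, IExp.cost]; omega) fun t₁ ⟨hF₁, hv₁⟩ => ?_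
  rw [← hS] at hv₁
  refine (Achieves.mapTo (n := d) (r₀ := 0) (fun j => s.arr 1 0 j) (by simp)
    (by rw [hF₁.idx 0 (by simp), hd])
    (fun _ _ => rfl) (fun k hk t hF hx _ => by
      simp [RExp.eval, IExp.eval, hF.arr, hF₁.arr, hx])).seqOf
    (by simp [RExp.cost, IExp.cost]; omega) fun t₂ ⟨hF₂, hv₂⟩ => ?_
  refine (Achieves.mapTo (n := d) (r₀ := 0) (fun j => s.arr 1 0 j) (by simp)
    (by rw [hF₂.idx 0 (by simp), hF₁.idx 0 (by simp), hd])
    (fun _ _ => rfl) (fun k hk t hF hx _ => by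
      simp [RExp.eval, IExp.eval, hF.arr, hF₁.arr, hF₂.arr, hx])).seqOf
    (by simp [RExp.cost, IExp.cost]; omega) fun t₃ ⟨hF₃, hv₃⟩ => ?_
  have hF13 : Frame [2, 3] [4, 5, 6, 11, 12] s t₃ :=
    ((hF₁.mono (by simp) (by simp)).trans (hF₂.mono (by simp) (by simp))).trans
      (hF₃.mono (by simp) (by simp))
  refine (Achieves.forTo (n := d) (B := 16) (I := fun k t => Frame [2] [5] t₃ t ∧
    t.arr 5 = fun i j => if i = j ∧ i < k then s.arr 0 0 0 * √S / 2 else 0) (by simp)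
    (by rw [hF13.idx 0 (by simp), hd]) ⟨(Frame.refl _ _ _).writeIdx (by simp) _, ?_⟩ ?_).seqOf
    (by simp [RExp.cost, IExp.cost]; omega) fun t₄ ⟨hF₄, hv₄⟩ => ?_
  · simp [hF₁.arr, hF₂.arr, hF₃.arr, h5]
  · rintro k hk t ⟨hF, ht⟩ hx hn
    refine .setReal (by simp [RExp.cost, IExp.cost]) ⟨hx, hn,
      (hF.writeReal (by simp) _ _ _).writeIdx (by simp) _, ?_⟩
    funext i j
    have e0 : t.arr 0 0 0 = s.arr 0 0 0 := by simp [hF.arr, hF13.arr]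
    have e12 : t.arr 12 0 0 = S := by simp [hF.arr, hF₃.arr, hF₂.arr, hv₁]
    simp only [State.writeIdx_arr, State.writeReal_arr, RExp.eval, IExp.eval, hx, true_and, ht,
      e0, e12, Nat.cast_ofNat]
    by_cases hik : i = k <;> by_cases hjk : j = k
    · simp [hik, hjk]
    · simp [hik, hjk, Ne.symm hjk]
    · simp [hik, hjk]
    · have : i < k + 1 ↔ i < k := by omega
      simp [hik, this]
  · refine .setReal (by simp [RExp.cost, IExp.cost]; omega)
      ⟨(hF13.trans (hF₄.mono (by simp) (by simp))).writeReal (by simp) _ _ _, ?_, ?_, ?_, ?_⟩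
    · intro j hj
      simp [hF₄.arr, hF₃.arr, hv₂, hj]
    · intro j hj
      simp [hF₄.arr, hv₃, hj]
    · intro i hi j hj
      simp [hv₄, hi]
    · simp [RExp.eval, IExp.eval]

end VoronoiMesh

namespace VoronoiMesh
open RealRAM

theorem achieves_findCut {s : State} {d m : ℕ} (hd : s.idx 0 = d) (hm : s.idx 1 = m) :
    Achieves findCut s (200 * (d + 1) * (m + 1)) (fun t => Frame [2, 3, 4] [7, 9] s t ∧
      ((t.idx 4 = 0 ∧ (∀ j < d, t.arr 7 0 j = -s.arr 2 0 j) ∧ ∀ i < m,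
          0 ≤ ∑ j ∈ Finset.range d, ((s.arr 6 0 j - s.arr 3 i j) ^ 2 -
            (s.arr 6 0 j - s.arr 1 0 j) ^ 2)) ∨
        (t.idx 4 = 1 ∧ ∃ i < m, (∀ j < d, t.arr 7 0 j = s.arr 3 i j - s.arr 1 0 j) ∧
          ∑ j ∈ Finset.range d, ((s.arr 6 0 j - s.arr 3 i j) ^ 2 -
            (s.arr 6 0 j - s.arr 1 0 j) ^ 2) < 0))) := by
  obtain ⟨D, hD⟩ : ∃ D : ℕ → ℝ, D = fun i => ∑ j ∈ Finset.range d,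
    ((s.arr 6 0 j - s.arr 3 i j) ^ 2 - (s.arr 6 0 j - s.arr 1 0 j) ^ 2) := ⟨_, rfl⟩
  have hD' : ∀ i, ∑ j ∈ Finset.range d, ((s.arr 6 0 j - s.arr 3 i j) ^ 2 -
      (s.arr 6 0 j - s.arr 1 0 j) ^ 2) = D i := fun i => by rw [hD]
  simp only [hD']
  have hB : 200 * (d + 1) * (m + 1) = 200 * (d * m) + 200 * d + 200 * m + 200 := by ring
  rw [hB]
  have h1 := Achieves.mapTo (x := 3) (N := 0) (n := d) (A := 7) (s := s) (r := .lit 0) (r₀ := 0)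
    (e := .sub (.nat 0) (.coord 2 3)) (fun j => -s.arr 2 0 j) (by simp) hd (fun _ _ => rfl)
    (fun k hk t hF hx _ => by simp [RExp.eval, IExp.eval, hF.arr, hx])
  refine h1.seqOf (by simp [RExp.cost, IExp.cost]; omega) fun t₁ ⟨hF₁, hv₁⟩ => ?_
  refine Achieves.seqOf (B₁ := 2) (Q := fun t => t = t₁.writeIdx 4 0)
    (.setIdx (by simp [IExp.cost]) rfl) (by simp [RExp.cost, IExp.cost]; omega) ?_
  rintro _ rfl
  -- Either no neighbor seen so far is violated and array `7` still holds `-c`, or the flag is set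
  -- and array `7` holds the normal of some violated bisector (a later violation overwrites an
  -- earlier one).
  refine (Achieves.forTo (n := m) (B := d * 80 + 60) (I := fun k t =>
    Frame [2, 3, 4] [7, 9] s t ∧
      ((t.idx 4 = 0 ∧ (∀ j < d, t.arr 7 0 j = -s.arr 2 0 j) ∧ ∀ i < k, 0 ≤ D i) ∨
        (t.idx 4 = 1 ∧ ∃ i < m, (∀ j < d, t.arr 7 0 j = s.arr 3 i j - s.arr 1 0 j) ∧ D i < 0)))
    (by simp) (by simp [hF₁.idx, hm]) ⟨(((hF₁.mono (by simp) (by simp)).writeIdx (by simp)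
      _).writeIdx (by simp) _), .inl ⟨by simp, ?_, by simp⟩⟩ ?_).mono ?_ fun _ h => h
  · intro j hj
    simp [hv₁, hj]
  · rintro k hk t ⟨hF, ht⟩ hx hn
    have hd' : t.idx 0 = d := by rw [hF.idx 0 (by simp), hd]
    refine (Achieves.sumTo (n := d) (fun j => (s.arr 6 0 j - s.arr 3 k j) ^ 2 -
      (s.arr 6 0 j - s.arr 1 0 j) ^ 2) (by simp) hd' fun j hj u hu hux => by
        simp [RExp.eval, IExp.eval, hF.arr, hu.arr, hu.idx, hux, hx, pow_two]).seqOf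
      (by simp [RExp.cost, IExp.cost]; omega) fun u ⟨hu, hv⟩ => ?_
    rw [hD'] at hv
    have hFu : Frame [2, 3, 4] [7, 9] s u := hF.trans (hu.mono (by simp) (by simp))
    refine Achieves.mono (Achieves.branch (B := d * 30 + 20) (fun hb => ?_) fun hb => ?_)
      (by simp [Test.cost, RExp.cost, IExp.cost]; omega) fun _ h => h
    · refine .skip (by omega) ⟨by simp [hu.idx, hx], by simp [hu.idx, hn],
        hFu.writeIdx (by simp) _, ?_⟩
      simp only [Test.Holds, RExp.eval, IExp.eval, Nat.cast_zero, hv] at hb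
      rcases ht with ⟨h4, h7, hi⟩ | ⟨h4, i, hi, h7, hDi⟩
      · refine .inl ⟨by simp [hu.idx, h4], fun j hj => by simp [hu.arr, h7 j hj], fun i hik => ?_⟩
        rcases Nat.lt_succ_iff_lt_or_eq.1 hik with h | rfl
        · exact hi i h
        · exact hb
      · exact .inr ⟨by simp [hu.idx, h4], i, hi, fun j hj => by simp [hu.arr, h7 j hj], hDi⟩
    · simp only [Test.Holds, RExp.eval, IExp.eval, Nat.cast_zero, hv, not_le] at hb
      refine Achieves.seqOf (B₁ := 2) (Q := fun t => t = u.writeIdx 4 1)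
        (.setIdx (by simp [IExp.cost]) rfl) (by omega) ?_
      rintro _ rfl
      refine (Achieves.mapTo (n := d) (r₀ := 0) (fun j => s.arr 3 k j - s.arr 1 0 j) (by simp)
        (by simp [hu.idx, hd']) (fun _ _ => rfl) (fun j hj v hv' hvx _ => by
          simp [RExp.eval, IExp.eval, hv'.arr, hFu.arr, hv'.idx, hu.idx, hvx, hx])).mono
        (by simp [RExp.cost, IExp.cost]; omega) ?_
      rintro v ⟨hFv, hv7⟩
      refine ⟨by simp [hFv.idx, hu.idx, hx], by simp [hFv.idx, hu.idx, hn],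
        ((hFu.writeIdx (by simp) _).trans (hFv.mono (by simp) (by simp))).writeIdx (by simp) _,
        .inr ⟨by simp [hFv.idx], k, hk, fun j hj => by simp [hv7, hj], hb⟩⟩
  · have : m * (d * 80 + 60 + 8) + 6 = 80 * (d * m) + 68 * m + 6 := by ring
    rw [this]
    simp [RExp.cost, IExp.cost]; omega

theorem achieves_recordBest {s : State} {d : ℕ} (hd : s.idx 0 = d) :
    Achieves recordBest s (100 * (d + 1)) (fun t => Frame [3] [4, 9] s t ∧
      (s.idx 4 ≠ 0 → t.arr 4 = s.arr 4) ∧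
      (s.idx 4 = 0 →
        (t.arr 4 = s.arr 4 ∧
          ∑ j ∈ Finset.range d, s.arr 2 0 j * (s.arr 6 0 j - s.arr 4 0 j) ≤ 0) ∨
        (0 ≤ ∑ j ∈ Finset.range d, s.arr 2 0 j * (s.arr 6 0 j - s.arr 4 0 j) ∧
          ∀ j < d, t.arr 4 0 j = s.arr 6 0 j))) := by
  refine Achieves.mono (Achieves.branch (B := 80 * (d + 1)) (fun hb => ?_) fun hb => ?_)
    (by simp [Test.cost, IExp.cost]; omega) fun _ h => h
  · simp only [Test.Holds, IExp.eval, Nat.le_zero] at hb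
    refine (Achieves.sumTo (n := d) (fun j => s.arr 2 0 j * (s.arr 6 0 j - s.arr 4 0 j)) (by simp)
      hd fun j hj u hu hux => by simp [RExp.eval, IExp.eval, hu.arr, hux]).seqOf
      (by simp [RExp.cost, IExp.cost]; omega) fun u ⟨hu, hv⟩ => ?_
    refine Achieves.mono (Achieves.branch (B := d * 30 + 20) (fun hb' => ?_) fun hb' => ?_)
      (by simp [Test.cost, RExp.cost, IExp.cost]; omega) fun _ h => h
    · simp only [Test.Holds, RExp.eval, IExp.eval, Nat.cast_zero, hv] at hb'
      refine (Achieves.mapTo (n := d) (r₀ := 0) (fun j => s.arr 6 0 j) (by simp)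
        (by simp [hu.idx, hd]) (fun _ _ => rfl) (fun j hj v hv' hvx _ => by
          simp [RExp.eval, IExp.eval, hv'.arr, hu.arr, hvx])).mono
        (by simp [RExp.cost, IExp.cost]; omega) ?_
      rintro v ⟨hFv, hv4⟩
      exact ⟨(hu.mono (by simp) (by simp)).trans (hFv.mono (by simp) (by simp)),
        fun h => absurd hb h, fun _ => .inr ⟨hb', fun j hj => by simp [hv4, hj]⟩⟩
    · simp only [Test.Holds, RExp.eval, IExp.eval, Nat.cast_zero, hv, not_le] at hb'
      exact .skip (by omega) ⟨hu.mono (by simp) (by simp), fun h => absurd hb h,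
        fun _ => .inl ⟨hu.arr 4 (by simp), hb'.le⟩⟩
  · simp only [Test.Holds, IExp.eval, Nat.le_zero] at hb
    exact .skip (by omega) ⟨.refl _ _ _, fun _ => rfl, fun h => absurd h hb⟩

theorem eval_depthExp {s : State} {d : ℕ} (hd : s.idx 0 = d) :
    depthExp.eval s = 1 / (4 * (d : ℝ)) := by
  simp [depthExp, RExp.eval, IExp.eval, hd]

theorem achieves_updateEllipsoid {s : State} {d : ℕ} (hd : s.idx 0 = d) :
    Achieves updateEllipsoid s (400 * (d + 1) * (d + 1)) (fun t =>
      Frame [2, 3] [5, 6, 8, 9, 10, 11, 12] s t ∧ ∃ (u h : ℕ → ℝ) (S : ℝ),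
        (∀ j < d, u j = ∑ i ∈ Finset.range d, s.arr 5 i j * s.arr 7 0 i) ∧
        S = ∑ j ∈ Finset.range d, u j ^ 2 ∧
        (∀ i < d, h i = ∑ j ∈ Finset.range d, s.arr 5 i j * u j) ∧
        (∀ j < d, t.arr 6 0 j = s.arr 6 0 j - 1 / (4 * d) / √S * h j) ∧
        (∀ i < d, ∀ j < d, t.arr 5 i j = (1 + (1 / (4 * d)) ^ 2) * s.arr 5 i j -
          (1 / (4 * d) + (1 / (4 * d)) ^ 2) * u j / S * h i) ∧
        t.arr 11 0 0 = s.arr 11 0 0 * (1 - 1 / (8 * (d * d)))) := by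
  have hB : 400 * (d + 1) * (d + 1) = 400 * (d * d) + 800 * d + 400 := by ring
  rw [hB]
  have h1 := Achieves.sumMapTo (x := 2) (y := 3) (N := 0) (n := d) (A := 8) (s := s)
    (e := .mul (.entry 5 3 2) (.coord 7 3)) (fun j i => s.arr 5 i j * s.arr 7 0 i)
    (by simp) (by simp) (by simp) (by simp) hd (fun i hi j hj t hF hx hy => by
      simp [RExp.eval, IExp.eval, hF.arr, hx, hy])
  simp only [RExp.cost, IExp.cost] at h1
  have e1 : d * (d * (1 + 1 + 1 + (1 + 1 + 1) + 1 + 15) + 25) + 6 = 22 * (d * d) + 25 * d + 6 := by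
    ring
  rw [e1] at h1
  refine h1.seqOf (by omega) fun t₁ ⟨hF₁, hv₁⟩ => ?_
  obtain ⟨u, hu⟩ : ∃ u : ℕ → ℝ, u = fun j => t₁.arr 8 0 j := ⟨_, rfl⟩
  obtain ⟨S, hS⟩ : ∃ S : ℝ, S = ∑ j ∈ Finset.range d, u j ^ 2 := ⟨_, rfl⟩
  obtain ⟨h, hh⟩ : ∃ h : ℕ → ℝ, h = fun i => ∑ j ∈ Finset.range d, s.arr 5 i j * u j := ⟨_, rfl⟩
  refine (Achieves.sumTo (n := d) (fun j => u j ^ 2) (by simp)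
    (by simp [hF₁.idx, hd]) fun j hj v hF hx => by
      simp [RExp.eval, IExp.eval, hF.arr, hx, hu, pow_two]).seqOf
    (by simp [RExp.cost, IExp.cost]; omega) fun t₂ ⟨hF₂, hv₂⟩ => ?_
  rw [← hS] at hv₂
  have h3 := Achieves.sumMapTo (x := 2) (y := 3) (N := 0) (n := d) (A := 10) (s := t₂)
    (e := .mul (.entry 5 2 3) (.coord 8 3)) (fun i j => s.arr 5 i j * u j)
    (by simp) (by simp) (by simp) (by simp) (by simp [hF₂.idx, hF₁.idx, hd])
    (fun i hi j hj t hF hx hy => by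
      simp [RExp.eval, IExp.eval, hF.arr, hF₁.arr, hF₂.arr, hx, hy, hu])
  simp only [RExp.cost, IExp.cost] at h3
  rw [e1] at h3
  refine h3.seqOf (by simp [RExp.cost, IExp.cost]; omega) fun t₃ ⟨hF₃, hv₃⟩ => ?_
  have hF13 : Frame [2, 3] [5, 6, 8, 9, 10, 11, 12] s t₃ :=
    ((hF₁.mono (by simp) (by simp)).trans (hF₂.mono (by simp) (by simp))).trans
      (hF₃.mono (by simp) (by simp))
  have hd3 : t₃.idx 0 = d := by rw [hF13.idx 0 (by simp), hd]
  refine (Achieves.mapTo (n := d) (r₀ := 0)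
    (fun j => s.arr 6 0 j - 1 / (4 * (d : ℝ)) / √S * h j) (by simp) hd3
    (fun _ _ => rfl) (fun k hk t hF hx hA => by
      have e6 : t.arr 6 0 k = s.arr 6 0 k := by
        rw [hA k le_rfl]; simp [hF₁.arr, hF₂.arr, hF₃.arr]
      have e12 : t.arr 12 0 0 = S := by simp [hF.arr, hF₃.arr, hv₂]
      have e10 : t.arr 10 0 k = h k := by
        rw [hF.arr 10 (by simp), hv₃ k hk, hh]
      simp only [RExp.eval, IExp.eval, hx, e6, e12, e10,
        eval_depthExp (show t.idx 0 = d by rw [hF.idx 0 (by simp), hd3])])).seqOf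
    (by simp [RExp.cost, IExp.cost, depthExp]; omega) fun t₄ ⟨hF₄, hv₄⟩ => ?_
  have hd4 : t₄.idx 0 = d := by rw [hF₄.idx 0 (by simp), hd3]
  refine (Achieves.forTo (n := d) (B := 80 * d + 6) (I := fun k t => Frame [2, 3] [5] t₄ t ∧
    t.arr 5 = fun i j => if i < k ∧ j < d then (1 + (1 / (4 * d)) ^ 2) * s.arr 5 i j -
          (1 / (4 * d) + (1 / (4 * d)) ^ 2) * u j / S * h i else s.arr 5 i j) (by simp) hd4
    ⟨(Frame.refl _ _ _).writeIdx (by simp) _, ?_⟩ ?_).seqOf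
    ?_ fun t₅ ⟨hF₅, hv₅⟩ => ?_
  · simp [hF₁.arr, hF₂.arr, hF₃.arr, hF₄.arr]
  · rintro k hk t ⟨hF, ht⟩ hx hn
    refine (Achieves.mapTo (n := d) (r₀ := k)
      (fun j => (1 + (1 / (4 * d)) ^ 2) * s.arr 5 k j -
          (1 / (4 * d) + (1 / (4 * d)) ^ 2) * u j / S * h k) (by simp) hn
      (fun v hv => by simp [IExp.eval, hv.idx, hx]) (fun j hj v hv hvx hA => by
        have e5 : v.arr 5 k j = s.arr 5 k j := by
          rw [hA j le_rfl]; simp [ht]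
        have e12 : v.arr 12 0 0 = S := by simp [hv.arr, hF.arr, hF₄.arr, hF₃.arr, hv₂]
        have e10 : v.arr 10 0 k = h k := by
          rw [hv.arr 10 (by simp), hF.arr 10 (by simp), hF₄.arr 10 (by simp), hv₃ k hk, hh]
        have e8 : v.arr 8 0 j = u j := by
          simp [hv.arr, hF.arr, hF₄.arr, hF₃.arr, hF₂.arr, hu]
        have e2 : v.idx 2 = k := by rw [hv.idx 2 (by simp), hx]
        simp only [RExp.eval, IExp.eval, hvx, e2, e5, e12, e10, e8, Nat.cast_one, pow_two,
          eval_depthExp (show v.idx 0 = d by rw [hv.idx 0 (by simp), hn])])).mono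
      (by simp [RExp.cost, IExp.cost, depthExp]; omega) fun v ⟨hFv, hv⟩ => ?_
    refine ⟨by rw [hFv.idx 2 (by simp), hx], by rw [hFv.idx 0 (by simp), hn],
      (hF.trans (hFv.mono (by simp) (by simp))).writeIdx (by simp) _, ?_⟩
    funext i j
    simp only [State.writeIdx_arr, hv, ht]
    by_cases hik : i = k
    · subst hik; simp
    · have : i < k + 1 ↔ i < k := by omega
      simp [hik, this]
  · have : d * (80 * d + 6 + 8) + 6 = 80 * (d * d) + 14 * d + 6 := by ring
    rw [this]
    simp [RExp.cost, IExp.cost, depthExp]; omega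
  · refine .setReal ?_
      ⟨((hF13.trans (hF₄.mono (by simp) (by simp))).trans
        (hF₅.mono (by simp) (by simp))).writeReal (by simp) _ _ _, u, h, S, ?_, hS, ?_, ?_, ?_, ?_⟩
    · have : d * (80 * d + 6 + 8) + 6 = 80 * (d * d) + 14 * d + 6 := by ring
      rw [this]
      simp [RExp.cost, IExp.cost, depthExp]; omega
    · intro j hj
      rw [hu]; exact hv₁ j hj
    · intro i hi
      rw [hh]
    · intro j hj
      simp [hF₅.arr, hv₄, hj]
    · intro i hi j hj
      simp [hv₅, hi, hj]
    · have e11 : t₅.arr 11 0 0 = s.arr 11 0 0 := by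
        simp [hF₅.arr, hF₄.arr, hF₃.arr, hF₂.arr, hF₁.arr]
      simp [RExp.eval, IExp.eval, e11, hF₅.idx, hd4]

end VoronoiMesh

/-! ### From memory contents to geometry: the loop invariant and correctness -/

namespace VoronoiMesh
open RealRAM Module

variable {d : ℕ}

/-- The vector of the first `d` entries of a row. -/
noncomputable def rowVec (d : ℕ) (f : ℕ → ℝ) : Pt d := WithLp.toLp 2 fun j => f j

/-- The linear map given by the leading `d × d` block of an array. -/
noncomputable def arrayMap (d : ℕ) (F : ℕ → ℕ → ℝ) : Pt d →ₗ[ℝ] Pt d :=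
  Matrix.toEuclideanLin (Matrix.of fun (i j : Fin d) => F i j)

@[simp] theorem rowVec_apply (f : ℕ → ℝ) (j : Fin d) : rowVec d f j = f j := rfl

theorem arrayMap_apply (F : ℕ → ℕ → ℝ) (x : Pt d) (i : Fin d) :
    arrayMap d F x i = ∑ j : Fin d, F i j * x j := by
  simp [arrayMap, Matrix.toLpLin_apply, Matrix.mulVec, dotProduct]

theorem arrayMap_rowVec (F : ℕ → ℕ → ℝ) (f : ℕ → ℝ) (i : Fin d) :
    arrayMap d F (rowVec d f) i = ∑ j ∈ Finset.range d, F i j * f j := by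
  rw [arrayMap_apply, Finset.sum_range]; rfl

theorem inner_eq_sum (x y : Pt d) : inner ℝ x y = ∑ j, x j * y j := by
  simp [PiLp.inner_apply, mul_comm]

theorem norm_rowVec_sq (f : ℕ → ℝ) : ‖rowVec d f‖ ^ 2 = ∑ j ∈ Finset.range d, f j ^ 2 := by
  rw [← real_inner_self_eq_norm_sq, inner_eq_sum, Finset.sum_range]
  simp [pow_two]

theorem dist_rowVec_le_iff (x p q : ℕ → ℝ) :
    dist (rowVec d x) (rowVec d p) ≤ dist (rowVec d x) (rowVec d q) ↔
      0 ≤ ∑ j ∈ Finset.range d, ((x j - q j) ^ 2 - (x j - p j) ^ 2) := by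
  have h : ∀ y : ℕ → ℝ, dist (rowVec d x) (rowVec d y) ^ 2 =
      ∑ j ∈ Finset.range d, (x j - y j) ^ 2 := fun y => by
    rw [dist_eq_norm, ← norm_rowVec_sq]; rfl
  rw [← sq_le_sq₀ dist_nonneg dist_nonneg, h, h, Finset.sum_sub_distrib, sub_nonneg]

/-- The part of the memory that stays constant in the main loop. -/
def Constants (s t : State) : Prop := Frame [2, 3, 4] [4, 5, 6, 7, 8, 9, 10, 11, 12] s t

/-- In matrix form `u = Lᵀg`, `h = Lu` and `L' = (1+α²)L - ((α+α²)/S)·h·uᵀ`, which is `cutMap`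
written in coordinates. -/
theorem cut_of_updateEllipsoid {L L' : ℕ → ℕ → ℝ} {a a' g u h : ℕ → ℝ} {S α : ℝ}
    (hu : ∀ j < d, u j = ∑ i ∈ Finset.range d, L i j * g i)
    (hS : S = ∑ j ∈ Finset.range d, u j ^ 2)
    (hh : ∀ i < d, h i = ∑ j ∈ Finset.range d, L i j * u j)
    (ha : ∀ j < d, a' j = a j - α / √S * h j)
    (hL : ∀ i < d, ∀ j < d, L' i j = (1 + α ^ 2) * L i j - (α + α ^ 2) * u j / S * h i) :
    (∀ x, inner ℝ (rowVec d u) x = inner ℝ (rowVec d g) (arrayMap d L x)) ∧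
    rowVec d a' = rowVec d a - (α / ‖rowVec d u‖) • arrayMap d L (rowVec d u) ∧
    arrayMap d L' = cutMap (arrayMap d L) (rowVec d u) α := by
  have hn : ‖rowVec d u‖ ^ 2 = S := by rw [norm_rowVec_sq, hS]
  have hn' : √S = ‖rowVec d u‖ := by rw [← hn, Real.sqrt_sq (norm_nonneg _)]
  have hAu : ∀ i : Fin d, arrayMap d L (rowVec d u) i = h i := fun i => by
    rw [arrayMap_rowVec, hh i i.2]
  refine ⟨fun x => ?_, ?_, ?_⟩
  · simp only [inner_eq_sum, rowVec_apply, arrayMap_apply, Finset.mul_sum]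
    rw [Finset.sum_comm]
    refine Finset.sum_congr rfl fun j _ => ?_
    rw [hu j j.2, Finset.sum_range, Finset.sum_mul]
    exact Finset.sum_congr rfl fun i _ => by ring
  · ext j
    simp only [PiLp.sub_apply, PiLp.smul_apply, hAu, rowVec_apply, smul_eq_mul, ha j j.2, hn']
  · refine LinearMap.ext fun x => ?_
    rw [cutMap_apply]
    ext i
    simp only [PiLp.sub_apply, PiLp.smul_apply, hAu, smul_eq_mul, arrayMap_apply, hn, inner_eq_sum,
      rowVec_apply]
    rw [Finset.mul_sum, Finset.mul_sum, Finset.sum_div, Finset.sum_mul, ← Finset.sum_sub_distrib]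
    refine Finset.sum_congr rfl fun j _ => ?_
    rw [hL i i.2 j j.2]
    ring

/-- The invariant of the main loop after `k` rounds: `T` is a set of good points of the cell `V`,
and `R` is the radius of the initial ellipsoid. -/
structure LoopInvariant (d : ℕ) (s : State) (V T : Set (Pt d)) (good : Pt d → Prop) (R : ℝ)
    (k : ℕ) (t : State) : Prop where
  const : Constants s t
  best_mem : rowVec d (t.arr 4 0) ∈ V
  det_pos : 0 < LinearMap.det (arrayMap d (t.arr 5))
  det_le : LinearMap.det (arrayMap d (t.arr 5)) ≤ (R * (1 - 1 / (8 * (d * d)) : ℝ) ^ k) ^ d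
  counter : t.arr 11 0 0 = (1 - 1 / (8 * (d * d)) : ℝ) ^ k
  subset : ¬ good (rowVec d (t.arr 4 0)) →
    T ⊆ ellipsoid (arrayMap d (t.arr 5)) (rowVec d (t.arr 6 0))

/-- The preparation of a cut: afterwards array `7` holds the normal vector `g` of a half-space
through the center that contains the good points. -/
theorem achieves_findCut_recordBest {s t : State} {V T : Set (Pt d)} {R : ℝ} {k m : ℕ} {η : ℝ}
    {p c : Pt d} {q : Fin m → Pt d} (hd : s.idx 0 = d) (hm : s.idx 1 = m)
    (hp : p = rowVec d (s.arr 1 0)) (hc : c = rowVec d (s.arr 2 0)) (hc0 : c ≠ 0)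
    (hq : ∀ i : Fin m, q i = rowVec d (s.arr 3 i)) (hqp : ∀ i, q i ≠ p)
    (hVq : ∀ x ∈ V, ∀ i, dist x p ≤ dist x (q i)) (hqV : ∀ x, (∀ i, dist x p ≤ dist x (q i)) → x ∈ V)
    (hTV : T ⊆ V) (hTη : ∀ x ∈ T, η ≤ inner ℝ (x - p) c)
    (hI : LoopInvariant d s V T (fun x => η ≤ inner ℝ (x - p) c) R k t) :
    Achieves (.seq findCut recordBest) t (200 * (d + 1) * (m + 1) + 100 * (d + 1)) (fun t' =>
      LoopInvariant d s V T (fun x => η ≤ inner ℝ (x - p) c) R k t' ∧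
      rowVec d (t'.arr 7 0) ≠ 0 ∧ (¬ η ≤ inner ℝ (rowVec d (t'.arr 4 0) - p) c → ∀ y ∈ T,
        inner ℝ (rowVec d (t'.arr 7 0)) (y - rowVec d (t'.arr 6 0)) ≤ 0)) := by
  have hcst := hI.const
  refine (achieves_findCut (by rw [hcst.idx 0 (by simp), hd])
    (by rw [hcst.idx 1 (by simp), hm])).seq fun t₁ ⟨hF₁, hcut⟩ => ?_
  refine (achieves_recordBest (d := d) (by rw [hF₁.idx 0 (by simp), hcst.idx 0 (by simp), hd])).mono
    le_rfl fun t₂ ⟨hF₂, hkeep, hbest⟩ => ?_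
  rw [hcst.arr 1 (by simp), hcst.arr 2 (by simp), hcst.arr 3 (by simp)] at hcut
  have e4 : t₁.arr 4 = t.arr 4 := hF₁.arr 4 (by simp)
  have e5 : t₂.arr 5 = t.arr 5 := by rw [hF₂.arr 5 (by simp), hF₁.arr 5 (by simp)]
  have e6 : t₂.arr 6 = t.arr 6 := by rw [hF₂.arr 6 (by simp), hF₁.arr 6 (by simp)]
  have e6' : t₁.arr 6 = t.arr 6 := hF₁.arr 6 (by simp)
  have e7 : t₂.arr 7 = t₁.arr 7 := hF₂.arr 7 (by simp)
  have e11 : t₂.arr 11 = t.arr 11 := by rw [hF₂.arr 11 (by simp), hF₁.arr 11 (by simp)]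
  have hconst : Constants s t₂ :=
    (hcst.trans (hF₁.mono (by simp) (by simp))).trans (hF₂.mono (by simp) (by simp))
  rw [e7, e6]
  obtain ⟨a, ha⟩ : ∃ a, a = rowVec d (t.arr 6 0) := ⟨_, rfl⟩
  rcases hcut with ⟨h4, h7, hall⟩ | ⟨h4, i, hi, h7, hneg⟩
  · have hg : rowVec d (t₁.arr 7 0) = -c := by
      ext j; rw [hc]; simp [h7 j j.2]
    have haV : a ∈ V := hqV a fun i => by
      rw [ha, hp, hq, dist_rowVec_le_iff]; exact hall i i.2
    have hsum : ∑ j ∈ Finset.range d, t₁.arr 2 0 j * (t₁.arr 6 0 j - t₁.arr 4 0 j) =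
        inner ℝ (a - rowVec d (t.arr 4 0)) c := by
      rw [e4, e6', hF₁.arr 2 (by simp), hcst.arr 2 (by simp), Finset.sum_range, inner_eq_sum, ha,
        hc]
      simp [mul_comm]
    -- Whether or not the feasible center `a` is recorded, the new best point lies in the cell and
    -- is at least as good as both `a` and the old one.
    have hb : rowVec d (t₂.arr 4 0) ∈ V ∧ inner ℝ (a - rowVec d (t₂.arr 4 0)) c ≤ 0 ∧
        inner ℝ (rowVec d (t.arr 4 0) - rowVec d (t₂.arr 4 0)) c ≤ 0 := by
      rcases hbest h4 with ⟨hb, hle⟩ | ⟨hle, hb⟩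
      · rw [hsum] at hle
        rw [hb, e4, sub_self, inner_zero_left]
        exact ⟨hI.best_mem, hle, le_rfl⟩
      · have hba : rowVec d (t₂.arr 4 0) = a := by ext j; rw [ha]; simp [hb j j.2, e6']
        rw [hsum] at hle
        rw [hba, sub_self, inner_zero_left, ← neg_sub, inner_neg_left]
        exact ⟨haV, le_rfl, by linarith⟩
    obtain ⟨hb1, hb2, hb3⟩ := hb
    simp only [inner_sub_left] at hb2 hb3
    refine ⟨⟨hconst, hb1, by rw [e5]; exact hI.det_pos, by rw [e5]; exact hI.det_le,
      by rw [e11]; exact hI.counter, fun hbad => ?_⟩, by rw [hg]; simpa using hc0,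
      fun hbad y hy => ?_⟩
    · rw [e5, e6]
      refine hI.subset fun hgood => hbad ?_
      rw [inner_sub_left] at hgood ⊢
      linarith
    -- If the best point is still below `η`, then so is `a`, while all of `T` is at height at least
    -- `η`; cutting with normal `-c` loses nothing of `T`.
    · rw [hg, ← ha, inner_neg_left, real_inner_comm, inner_sub_left]
      have := hTη y hy
      rw [inner_sub_left] at this hbad
      linarith
  · have hg : rowVec d (t₁.arr 7 0) = q ⟨i, hi⟩ - p := by
      ext j; rw [hp, hq]; simp [h7 j j.2]
    have hz : t₂.arr 4 = t.arr 4 := by rw [hkeep (by rw [h4]; simp), e4]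
    refine ⟨⟨hconst, by rw [hz]; exact hI.best_mem, by rw [e5]; exact hI.det_pos,
      by rw [e5]; exact hI.det_le, by rw [e11]; exact hI.counter,
      by rw [hz, e5, e6]; exact hI.subset⟩, by rw [hg]; exact sub_ne_zero.2 (hqp _),
      fun _ y hy => ?_⟩
    -- The bisector separates `y`, which satisfies its constraint, from the center `a`, which
    -- violates it; the parallel hyperplane through `a` therefore keeps `y`.
    have h1 := (dist_le_dist_iff_inner y p (q ⟨i, hi⟩)).1 (hVq y (hTV hy) _)
    have h2 : ¬ dist a p ≤ dist a (q ⟨i, hi⟩) := by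
      rw [ha, hp, hq, dist_rowVec_le_iff]; exact not_le.2 hneg
    rw [dist_le_dist_iff_inner, not_le] at h2
    rw [hg, ← ha, ← sub_sub_sub_cancel_right y a p, inner_sub_right]
    linarith

theorem LoopInvariant.updateEllipsoid {s t : State} {V T : Set (Pt d)} {good : Pt d → Prop}
    {R : ℝ} {k : ℕ} (hd : s.idx 0 = d) (hd0 : 0 < d)
    (hI : LoopInvariant d s V T good R k t) (hg0 : rowVec d (t.arr 7 0) ≠ 0)
    (hg : ¬ good (rowVec d (t.arr 4 0)) → ∀ y ∈ T,
      inner ℝ (rowVec d (t.arr 7 0)) (y - rowVec d (t.arr 6 0)) ≤ 0) :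
    Achieves updateEllipsoid t (400 * (d + 1) * (d + 1)) (LoopInvariant d s V T good R (k + 1)) := by
  refine (achieves_updateEllipsoid (d := d) (by rw [hI.const.idx 0 (by simp), hd])).mono le_rfl ?_
  rintro t' ⟨hF, u, h, S, hu, hS, hh, ha, hL, h11⟩
  obtain ⟨hadj, hcenter, hmap⟩ := cut_of_updateEllipsoid hu hS hh ha hL
  have hd1 : (1 : ℝ) ≤ d := by exact_mod_cast hd0
  have hα0 : (0 : ℝ) < 1 / (4 * d) := by positivity
  have hα1 : (1 : ℝ) / (4 * d) ≤ 1 / 4 := by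
    apply one_div_le_one_div_of_le <;> linarith
  -- The map is invertible, so its adjoint cannot send the nonzero normal vector to zero.
  have hu0 : rowVec d u ≠ 0 := by
    intro h0
    have hsurj : Function.Surjective (arrayMap d (t.arr 5)) :=
      ((LinearMap.equivOfDetNeZero _ hI.det_pos.ne')).surjective
    obtain ⟨x, hx⟩ := hsurj (rowVec d (t.arr 7 0))
    have := hadj x
    rw [h0, inner_zero_left, hx, eq_comm, inner_self_eq_zero] at this
    exact hg0 this
  have e4 : t'.arr 4 = t.arr 4 := hF.arr 4 (by simp)
  have hfin : finrank ℝ (Pt d) = d := finrank_euclideanSpace_fin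
  have hdet := det_cutMap (arrayMap d (t.arr 5)) hu0 (1 / (4 * d)) (by rw [hfin]; exact hd0)
  rw [← hmap, hfin] at hdet
  refine ⟨hI.const.trans (hF.mono (by simp) (by simp)), by rw [e4]; exact hI.best_mem, ?_, ?_, ?_, ?_⟩
  · rw [hdet]
    have := hI.det_pos
    have : (0 : ℝ) < 1 - 1 / (4 * d) := by linarith
    positivity
  · rw [hdet]
    calc _ ≤ (1 - 1 / (8 * (d * d)) : ℝ) ^ d * (R * (1 - 1 / (8 * (d * d)) : ℝ) ^ k) ^ d :=
          mul_le_mul (cut_factor_le hd0) hI.det_le hI.det_pos.le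
            (pow_nonneg (by
              rw [sub_nonneg, div_le_one (by positivity)]; nlinarith) _)
      _ = _ := by rw [← mul_pow, pow_succ]; ring
  · rw [h11, hI.counter, pow_succ]
  · rw [e4, hmap, hcenter]
    exact fun hbad => subset_ellipsoid_cutMap hadj hu0 hα0 hα1 (hI.subset hbad) (hg hbad)

/-- The ellipsoid method: `T` is a ball of good points of the cell `V`. -/
theorem achieves_farthestPointProg {s : State} {V : Set (Pt d)} {τ ε η : ℝ} {m : ℕ}
    {p c y : Pt d} {q : Fin m → Pt d} (hd : s.idx 0 = d) (hd0 : 0 < d) (hm : s.idx 1 = m)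
    (hm0 : 0 < m) (hp : p = rowVec d (s.arr 1 0)) (hc : c = rowVec d (s.arr 2 0)) (hc0 : c ≠ 0)
    (hq : ∀ i : Fin m, q i = rowVec d (s.arr 3 i)) (hqp : ∀ i, q i ≠ p)
    (h5 : s.arr 5 = fun _ _ => 0) (hτ : s.arr 0 0 0 = τ) (hε : s.arr 0 0 1 = ε)
    (hτ1 : 1 < τ) (hε0 : 0 < ε) (hε1 : ε < 1)
    (hVq : ∀ x ∈ V, ∀ i, dist x p ≤ dist x (q i)) (hqV : ∀ x, (∀ i, dist x p ≤ dist x (q i)) → x ∈ V)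
    (hT : Metric.closedBall y (ε / (2 * τ ^ 2) * (τ * dist p (q ⟨0, hm0⟩) / 2)) ⊆
      V ∩ Metric.closedBall p (τ * dist p (q ⟨0, hm0⟩) / 2) ∩ {x | η ≤ inner ℝ (x - p) c}) :
    Achieves farthestPointProg s
      ((⌊8 * (d : ℝ) ^ 2 * Real.log (2 * τ ^ 2 / ε)⌋₊ + 1) * (1300 * (d + 1) ^ 2 * (m + 1)))
      (fun t => rowVec d (t.arr 4 0) ∈ V ∧ η ≤ inner ℝ (rowVec d (t.arr 4 0) - p) c) := by
  obtain ⟨R, hR⟩ : ∃ R, R = τ * dist p (q ⟨0, hm0⟩) / 2 := ⟨_, rfl⟩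
  rw [← hR] at hT
  have hR0 : 0 < R := by
    have := dist_pos.2 (hqp ⟨0, hm0⟩).symm
    rw [hR]; positivity
  obtain ⟨N, hN⟩ : ∃ N, N = ⌊8 * (d : ℝ) ^ 2 * Real.log (2 * τ ^ 2 / ε)⌋₊ + 1 := ⟨_, rfl⟩
  rw [← hN]
  obtain ⟨T, hTdef⟩ : ∃ T, T = Metric.closedBall y (ε / (2 * τ ^ 2) * R) := ⟨_, rfl⟩
  have hd1 : (1 : ℝ) ≤ d := by exact_mod_cast hd0
  have hδ0 : (0 : ℝ) ≤ 1 - 1 / (8 * (d * d)) := by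
    rw [sub_nonneg, div_le_one (by positivity)]; nlinarith
  have hfin : finrank ℝ (Pt d) = d := finrank_euclideanSpace_fin
  let I := LoopInvariant d s V T (fun x => η ≤ inner ℝ (x - p) c) R
  have hinit : Achieves initProg s (200 * (d + 1)) (I 0) := by
    refine (achieves_initProg hd h5).mono le_rfl ?_
    rintro t ⟨hF, h6, h4, hL, h11⟩
    have hz : rowVec d (t.arr 4 0) = p := by ext j; rw [hp]; simp [h4 j j.2]
    have ha : rowVec d (t.arr 6 0) = p := by ext j; rw [hp]; simp [h6 j j.2]
    have hsqrt : √(∑ j ∈ Finset.range d, (s.arr 3 0 j - s.arr 1 0 j) ^ 2) =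
        dist p (q ⟨0, hm0⟩) := by
      rw [← norm_rowVec_sq, Real.sqrt_sq (norm_nonneg _), dist_comm, dist_eq_norm, hp, hq]
      rfl
    rw [hsqrt, hτ, ← hR] at hL
    have hmap : arrayMap d (t.arr 5) = R • LinearMap.id := by
      refine LinearMap.ext fun x => ?_
      ext i
      rw [arrayMap_apply, LinearMap.smul_apply, LinearMap.id_apply, PiLp.smul_apply, smul_eq_mul,
        Finset.sum_eq_single i]
      · rw [hL i i.2 i i.2, if_pos rfl]
      · intro j _ hji
        rw [hL i i.2 j j.2, if_neg (fun h => hji (Fin.ext h).symm), zero_mul]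
      · simp
    have hdet : LinearMap.det (arrayMap d (t.arr 5)) = R ^ d := by
      rw [hmap, LinearMap.det_smul, LinearMap.det_id, hfin, mul_one]
    refine ⟨hF.mono (by simp) (by simp), ?_, ?_, ?_, ?_, fun _ => ?_⟩
    · rw [hz]; exact hqV p fun i => by rw [dist_self]; exact dist_nonneg
    · rw [hdet]; positivity
    · rw [hdet, pow_zero, mul_one]
    · rw [h11, pow_zero]
    · intro x hx
      have hx' := (hT (hTdef ▸ hx)).1.2
      rw [Metric.mem_closedBall, dist_eq_norm] at hx'
      refine ⟨R⁻¹ • (x - p), ?_, ?_⟩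
      · rw [norm_smul, norm_inv, Real.norm_of_nonneg hR0.le, inv_mul_le_iff₀ hR0, mul_one]
        exact hx'
      · rw [ha, hmap, LinearMap.smul_apply, LinearMap.id_apply, smul_smul,
          mul_inv_cancel₀ hR0.ne', one_smul, add_sub_cancel]
  have hguard : ∀ k t, I k t → ((Test.realLE (.div (.get 0 (.lit 0) (.lit 1))
      (.mul (.nat 2) (.sq (.cell 0)))) (.cell 11)).Holds t ↔
        ε / (2 * τ ^ 2) ≤ (1 - 1 / (8 * (d * d)) : ℝ) ^ k) := by
    intro k t hI
    simp [Test.Holds, RExp.eval, IExp.eval, hI.const.arr, hτ, hε, hI.counter, pow_two]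
  have hloop := hinit.seq fun t ht => Achieves.loop (I := I) (N := N)
    (B := 200 * (d + 1) * (m + 1) + 100 * (d + 1) + 400 * (d + 1) * (d + 1))
    (P := .seq (.seq findCut recordBest) updateEllipsoid)
    (b := .realLE (.div (.get 0 (.lit 0) (.lit 1)) (.mul (.nat 2) (.sq (.cell 0)))) (.cell 11)) (fun k t hI hb => by
      rw [hguard k t hI] at hb
      refine ⟨?_, ?_⟩
      -- The counter is at most `exp(-k/(8d²))`, so a true guard forces `k ≤ 8d²·log(2τ²/ε)`. The
      -- program itself thus needs no logarithm.
      · have h1 : (1 - 1 / (8 * (d * d)) : ℝ) ^ k ≤ Real.exp (-(k / (8 * d ^ 2))) := by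
          calc (1 - 1 / (8 * (d * d)) : ℝ) ^ k ≤ (Real.exp (-(1 / (8 * (d * d))))) ^ k := by
                gcongr
                linarith [Real.add_one_le_exp (-(1 / (8 * (d * d)) : ℝ))]
            _ = _ := by rw [← Real.exp_nat_mul]; congr 1; ring
        have h2 := hb.trans h1
        rw [← inv_div, Real.exp_neg] at h2
        have h3 := (inv_le_inv₀ (by positivity) (Real.exp_pos _)).1 h2
        rw [← Real.le_log_iff_exp_le (by positivity), div_le_iff₀ (by positivity)] at h3
        rw [hN, Nat.lt_succ_iff]
        exact Nat.le_floor (by linarith)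
      · exact (achieves_findCut_recordBest hd hm hp hc hc0 hq hqp hVq hqV
          (fun x hx => (hT (hTdef ▸ hx)).1.1) (fun x hx => (hT (hTdef ▸ hx)).2) hI).seq
          fun u hu => hu.1.updateEllipsoid hd hd0 hu.2.1 hu.2.2) ht
  refine hloop.mono ?_ ?_
  · have hN1 : 1 ≤ N := by omega
    obtain ⟨N', rfl⟩ := Nat.exists_eq_add_of_le hN1
    simp only [Test.cost, RExp.cost, IExp.cost]
    nlinarith [Nat.zero_le (N' * d), Nat.zero_le (N' * m), Nat.zero_le (N' * d * m), Nat.zero_le (d * m),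
      Nat.zero_le (N' * (d * d)), Nat.zero_le (N' * (d * d) * m), Nat.zero_le (d * d), Nat.zero_le (d * d * m)]
  · rintro t ⟨hb, k, -, hI⟩
    rw [hguard k t hI, not_le] at hb
    refine ⟨hI.best_mem, ?_⟩
    -- Otherwise `T` would lie in the last ellipsoid, and comparing volumes would give `ε/(2τ²) ≤
    -- (1-1/(8d²))^k`, against the failed guard.
    by_contra hbad
    have h1 := hI.subset hbad
    rw [hTdef] at h1
    have h2 := pow_le_abs_det_of_closedBall_subset_ellipsoid (by positivity) h1
    rw [abs_of_pos hI.det_pos, hfin] at h2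
    have h3 := (pow_le_pow_iff_left₀ (by positivity) (by positivity) hd0.ne').1 (h2.trans hI.det_le)
    nlinarith

end VoronoiMesh

/-! ### The time bound and the theorem -/

namespace VoronoiMesh
open RealRAM

/-- The number of steps is `2 ^ O(d) * O(log² (τ / ε))`. -/
theorem exists_time_bound {τ : ℝ} (hτ : 1 < τ) : ∃ C : ℕ, ∀ (d m : ℕ) (ε : ℝ), 0 < ε → ε < 1 →
    (m : ℝ) ≤ (2 * τ ^ 2 + 1) ^ d →
    (((⌊8 * (d : ℝ) ^ 2 * Real.log (2 * τ ^ 2 / ε)⌋₊ + 1) * (1300 * (d + 1) ^ 2 * (m + 1)) : ℕ) : ℝ)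
      ≤ 2 ^ (C * d) * (C * Real.log (τ / ε) ^ 2) := by
  obtain ⟨t, ht⟩ : ∃ t, t = Real.log τ := ⟨_, rfl⟩
  have ht0 : 0 < t := ht ▸ Real.log_pos hτ
  -- Here `20800 = 8·1300·2` collects the numerical factors, and `2/t² + 2/t` turns `2 + 2l` into a
  -- multiple of `l²`, as `l ≥ t`.
  obtain ⟨K, hK⟩ : ∃ K : ℝ, K = 20800 * (2 / t ^ 2 + 2 / t) := ⟨_, rfl⟩
  obtain ⟨a, ha⟩ := pow_unbounded_of_one_lt (2 * τ ^ 2 + 1) (one_lt_two (α := ℝ))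
  -- In the exponent, `a` pays for the number of neighbors and `4` for `(d+1)^4 ≤ 2^(4d)`; `⌈K⌉₊` is
  -- needed for the factor in front of `l²`.
  refine ⟨a + 4 + ⌈K⌉₊, fun d m ε hε0 hε1 hm => ?_⟩
  obtain ⟨l, hl⟩ : ∃ l, l = Real.log (τ / ε) := ⟨_, rfl⟩
  rw [← hl]
  have htl : t ≤ l := by
    rw [ht, hl]
    exact Real.log_le_log (by linarith) (by rw [le_div_iff₀ hε0]; nlinarith)
  have hΛ : Real.log (2 * τ ^ 2 / ε) ≤ 1 + 2 * l := by
    have h2 : 2 * τ ^ 2 / ε = 2 * τ * (τ / ε) := by ring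
    rw [h2, Real.log_mul (by positivity) (by positivity), Real.log_mul (by norm_num) (by positivity),
      ← ht, ← hl]
    have := Real.log_two_lt_d9
    linarith
  have hΛ0 : 0 ≤ Real.log (2 * τ ^ 2 / ε) := by
    refine Real.log_nonneg ?_
    rw [le_div_iff₀ hε0]; nlinarith
  have hl2 : 2 + 2 * l ≤ (2 / t ^ 2 + 2 / t) * l ^ 2 := by
    have h1 : 2 ≤ 2 / t ^ 2 * l ^ 2 := by
      rw [div_mul_eq_mul_div, le_div_iff₀ (by positivity)]; gcongr
    have h2 : 2 * l ≤ 2 / t * l ^ 2 := by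
      rw [div_mul_eq_mul_div, le_div_iff₀ ht0]; nlinarith
    linarith
  have hd2 : ((d : ℝ) + 1) ≤ 2 ^ d := by
    exact_mod_cast Nat.lt_two_pow_self (n := d)
  have hm2 : ((m : ℝ) + 1) ≤ 2 * 2 ^ (a * d) := by
    have h1 : (m : ℝ) ≤ 2 ^ (a * d) := by
      rw [pow_mul]
      exact hm.trans (pow_le_pow_left₀ (by positivity) ha.le d)
    have h2 : (1 : ℝ) ≤ 2 ^ (a * d) := one_le_pow₀ one_le_two
    linarith
  have hN : (⌊8 * (d : ℝ) ^ 2 * Real.log (2 * τ ^ 2 / ε)⌋₊ : ℝ) + 1 ≤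
      8 * (d + 1) ^ 2 * (2 + 2 * l) := by
    have h1 := Nat.floor_le (a := 8 * (d : ℝ) ^ 2 * Real.log (2 * τ ^ 2 / ε)) (by positivity)
    have h2 : 8 * (d : ℝ) ^ 2 * Real.log (2 * τ ^ 2 / ε) ≤ 8 * (d + 1) ^ 2 * (1 + 2 * l) := by
      gcongr; linarith
    nlinarith [sq_nonneg (d : ℝ), Nat.cast_nonneg (α := ℝ) d]
  push_cast
  calc _ ≤ 8 * (d + 1) ^ 2 * (2 + 2 * l) * (1300 * (d + 1) ^ 2 * (2 * 2 ^ (a * d))) := by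
        have : 0 ≤ 2 + 2 * l := by linarith
        gcongr
    _ = (d + 1) ^ 4 * 2 ^ (a * d) * (20800 * (2 + 2 * l)) := by ring
    _ ≤ (2 ^ d) ^ 4 * 2 ^ (a * d) * (20800 * ((2 / t ^ 2 + 2 / t) * l ^ 2)) := by
        have : 0 ≤ 2 + 2 * l := by linarith
        gcongr
    _ = 2 ^ ((a + 4) * d) * (K * l ^ 2) := by
        rw [hK, ← pow_mul, ← pow_add]; ring
    _ ≤ 2 ^ ((a + 4 + ⌈K⌉₊) * d) * ((a + 4 + ⌈K⌉₊) * l ^ 2) := by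
        have h1 := Nat.le_ceil K
        have h2 : (0 : ℝ) ≤ a := Nat.cast_nonneg a
        have h3 : 0 ≤ K := by rw [hK]; positivity
        refine mul_le_mul (pow_le_pow_right₀ one_le_two (Nat.mul_le_mul_right d (by omega)))
          (mul_le_mul_of_nonneg_right (by linarith) (by positivity)) (by positivity)
          (by positivity)

end VoronoiMesh

theorem mainTheorem5 :
    ∃ P : RealRAM.Prog, ∀ τ : ℝ, 1 < τ → ∃ C : ℕ,
      ∀ (d : ℕ) (M : Finset (VoronoiMesh.Pt d)) (G : SimpleGraph (VoronoiMesh.Pt d)),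
        VoronoiMesh.IsWellSpaced M τ → VoronoiMesh.IsApproxDelaunayGraph M τ G →
      ∀ p ∈ M, ∀ (m : ℕ) (q : Fin m → VoronoiMesh.Pt d),
        Function.Injective q → Set.range q = G.neighborSet p →
      ∀ c w : VoronoiMesh.Pt d, ‖c‖ = 1 → VoronoiMesh.IsFarthestCorner M p c w →
      ∀ ε : ℝ, 0 < ε → ε < 1 →
        ∃ (s : RealRAM.State) (n : ℕ),
          RealRAM.Exec P (VoronoiMesh.input τ ε p c q) s n ∧
          (n : ℝ) ≤ 2 ^ (C * d) * (C * Real.log (τ / ε) ^ 2) ∧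
          VoronoiMesh.output d s ∈ VoronoiMesh.voronoiCell M p ∧
          (1 - ε) * inner ℝ (w - p) c ≤ inner ℝ (VoronoiMesh.output d s - p) c := by
  refine ⟨VoronoiMesh.farthestPointProg, fun τ hτ => ?_⟩
  obtain ⟨C, hC⟩ := VoronoiMesh.exists_time_bound hτ
  refine ⟨C, fun d M G hM hG p hp m q hinj hq c w hc hw ε hε0 hε1 => ?_⟩
  have hτ0 : 0 < τ := by linarith
  -- In dimension `0` there is no unit vector `c`.
  have hd0 : 0 < d := by
    rcases Nat.eq_zero_or_pos d with rfl | h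
    · rw [Subsingleton.elim c 0, norm_zero] at hc
      norm_num at hc
    · exact h
  have hm0 := VoronoiMesh.card_neighbors_pos hG hp hq hc hw
  have hr := VoronoiMesh.inradius_pos_of_neighbor hG hτ0 hq ⟨0, hm0⟩
  obtain ⟨y, hy⟩ := VoronoiMesh.exists_closedBall_nearly_optimal hM hG hp hτ hq hc hw hε0 hε1
    ⟨0, hm0⟩ hr
  obtain ⟨s, n, hs, hn, hV, hη⟩ := VoronoiMesh.achieves_farthestPointProg
    (s := VoronoiMesh.input τ ε p c q) (τ := τ) (ε := ε) (p := p) (c := c) (q := q) (m := m)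
    (y := y) (V := VoronoiMesh.voronoiCell M p) (η := (1 - ε) * inner ℝ (w - p) c)
    (by simp [VoronoiMesh.input]) hd0 (by simp [VoronoiMesh.input]) hm0
    (by ext j; simp [VoronoiMesh.input]) (by ext j; simp [VoronoiMesh.input])
    (by rintro rfl; simp at hc) (fun i => by ext j; simp [VoronoiMesh.input])
    (fun i => (VoronoiMesh.dist_neighbor_le hG hτ0.le hq i).2.2.2.2)
    (by funext i j; simp [VoronoiMesh.input]) (by simp [VoronoiMesh.input])
    (by simp [VoronoiMesh.input]) hτ hε0 hε1
    (fun x hx i => hx _ (VoronoiMesh.dist_neighbor_le hG hτ0.le hq i).2.2.2.1)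
    (fun x hx => VoronoiMesh.mem_voronoiCell_of_forall_neighbor hG hp hq hx) hy
  exact ⟨s, n, hs, (Nat.cast_le.2 hn).trans
    (hC d m ε hε0 hε1 (VoronoiMesh.card_neighbors_le hG hτ hinj hq hr)), hV, hη⟩
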